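/- Let $\alpha,\beta\in(0,1)$ with $\alpha+\beta<1$, let $T=[0,2\pi]$, and let $f:\mathbb R^2\to\mathbb R$ be $2\pi$-periodic in each variable, integrable on $T^2$, and of bounded partial variation ($f\in PBV$), i.e. $$\sup_{y\in T}\ \operatorname{Var}_{T} f(\cdot,y)+\sup_{x\in T}\ \operatorname{Var}_{T} f(x,\cdot)<\infty .$$ Put $$\widehat f(k,l)=\frac1{4\pi^2}\int_0^{2\pi}\!\!\int_0^{2\pi} f(x,y)e^{-ikx}e^{-ily}\,dx\,dy,\qquad S_{M,N}[f,(x,y)]=\sum_{k=-M}^{M}\sum_{l=-N}^{N}\widehat f(k,l)e^{ikx}e^{ily},$$ and, for $a,b>-1$, $$\sigma_{n,m}^{a,b}f(x,y)=\frac1{A_n^{a}A_m^{b}}\sum_{i=0}^{n}\sum_{j=0}^{m}A_{n-i}^{a-1}A_{m-j}^{b-1}S_{i,j}[f,(x,y)],\qquad A_0^a=1,\quad A_k^{a}=\frac{(a+1)\cdots(a+k)}{k!}\ (k\ge 1).$$ Then the double Fourier series of $f$ is $(C;-\alpha,-\beta)$ summable to $\frac14\sum f(x\pm0,y\pm0)$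 wherever this makes sense: at every point $(x,y)$ at which the four open coordinate quadrant limits $f(x\pm0,y\pm0)$ (all four combinations of signs) exist, $$\lim_{n,m\to\infty}\sigma_{n,m}^{-\alpha,-\beta}f(x,y)=\tfrac14\big[f(x+0,y+0)+f(x+0,y-0)+f(x-0,y+0)+f(x-0,y-0)\big],$$ where $n$ and $m$ tend to infinity independently. Moreover, for every compact set $K\subset\mathbb R^2$ such that $f$ is continuous at every point of $K$, $\sigma_{n,m}^{-\alpha,-\beta}f\to f$ uniformly on $K$ as $n,m\to\infty$. -/

import Mathlib

open Filter Topology MeasureTheory Set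
open scoped Real ENNReal

noncomputable section

namespace DoubleFourier

/-- `f` has period `2π` with respect to each of its two variables. -/
def IsBiperiodic (f : ℝ × ℝ → ℝ) : Prop :=
  (∀ x y, f (x + 2 * π, y) = f (x, y)) ∧ (∀ x y, f (x, y + 2 * π) = f (x, y))

/-- Membership in `L¹(T²)`, where `T = [0, 2π]`. -/
def IsL1 (f : ℝ × ℝ → ℝ) : Prop :=
  IntegrableOn f (Icc 0 (2 * π) ×ˢ Icc 0 (2 * π)) volume

/-- Bounded partial variation: the variations on `T = [0, 2π]` of the sections
`f(·, y)` (over all `y ∈ T`) and `f(x, ·)` (over all `x ∈ T`) are uniformly bounded. -/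
def IsPBV (f : ℝ × ℝ → ℝ) : Prop :=
  (⨆ y ∈ Icc 0 (2 * π), eVariationOn (fun x => f (x, y)) (Icc 0 (2 * π))) +
    (⨆ x ∈ Icc 0 (2 * π), eVariationOn (fun y => f (x, y)) (Icc 0 (2 * π))) < ⊤

/-- The double trigonometric Fourier coefficient
`(1 / 4π²) ∫∫_{[0,2π]²} f(x, y) e^{-imx} e^{-iny} dx dy`. -/
def fourierCoeff₂ (f : ℝ × ℝ → ℝ) (m n : ℤ) : ℂ :=
  (1 / (4 * (π : ℂ) ^ 2)) * ∫ p in Icc 0 (2 * π) ×ˢ Icc 0 (2 * π),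
    (f p : ℂ) * Complex.exp (-(Complex.I * m * (p.1 : ℂ))) *
      Complex.exp (-(Complex.I * n * (p.2 : ℂ)))

/-- The rectangular partial sum `S_{M,N}[f, p]` of the double Fourier series of `f`. -/
def partialSum (f : ℝ × ℝ → ℝ) (M N : ℕ) (p : ℝ × ℝ) : ℂ :=
  ∑ m ∈ Finset.Icc (-(M : ℤ)) M, ∑ n ∈ Finset.Icc (-(N : ℤ)) N,
    fourierCoeff₂ f m n * Complex.exp (Complex.I * m * (p.1 : ℂ)) *
      Complex.exp (Complex.I * n * (p.2 : ℂ))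

/-- The Cesàro numbers `A_k^a = (a + 1) ⋯ (a + k) / k!`, with `A_0^a = 1`. -/
def cesaroNumber (a : ℝ) (k : ℕ) : ℝ :=
  (∏ i ∈ Finset.range k, (a + (i + 1))) / (k.factorial : ℝ)

/-- The Cesàro `(C; a, b)` mean `σ_{n,m}^{a,b} f(p)` of the double Fourier series of `f`. -/
def cesaroMean (a b : ℝ) (f : ℝ × ℝ → ℝ) (n m : ℕ) (p : ℝ × ℝ) : ℂ :=
  (1 / (cesaroNumber a n : ℂ)) * (1 / (cesaroNumber b m : ℂ)) *
    ∑ i ∈ Finset.range (n + 1), ∑ j ∈ Finset.range (m + 1),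
      (cesaroNumber (a - 1) (n - i) : ℂ) * (cesaroNumber (b - 1) (m - j) : ℂ) *
        partialSum f i j p

/-- `(C; a, b)` summability at the point `p` of the double Fourier series of `f` to `L`:
`σ_{n,m}^{a,b} f(p) → L` as `n, m → ∞` independently of each other. -/
def CesaroSummableAt (a b : ℝ) (f : ℝ × ℝ → ℝ) (p : ℝ × ℝ) (L : ℝ) : Prop :=
  Tendsto (fun nm : ℕ × ℕ => cesaroMean a b f nm.1 nm.2 p) (atTop ×ˢ atTop) (𝓝 (L : ℂ))

/-- `(C; a, b)` summability of the double Fourier series of `f` to `f`, uniformly on `K`. -/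
def CesaroSummableUniformlyOn (a b : ℝ) (f : ℝ × ℝ → ℝ) (K : Set (ℝ × ℝ)) : Prop :=
  TendstoUniformlyOn (fun (nm : ℕ × ℕ) p => cesaroMean a b f nm.1 nm.2 p)
    (fun p => (f p : ℂ)) (atTop ×ˢ atTop) K

/-- The four open coordinate quadrant limits of `f` at `(x, y)` exist:
`f(x+0, y+0) = q₁`, `f(x+0, y-0) = q₂`, `f(x-0, y+0) = q₃`, `f(x-0, y-0) = q₄`. -/
def HasQuadrantLimits (f : ℝ × ℝ → ℝ) (x y q₁ q₂ q₃ q₄ : ℝ) : Prop :=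
  Tendsto f (𝓝[>] x ×ˢ 𝓝[>] y) (𝓝 q₁) ∧ Tendsto f (𝓝[>] x ×ˢ 𝓝[<] y) (𝓝 q₂) ∧
    Tendsto f (𝓝[<] x ×ˢ 𝓝[>] y) (𝓝 q₃) ∧ Tendsto f (𝓝[<] x ×ˢ 𝓝[<] y) (𝓝 q₄)

end DoubleFourier

end

/-! The mean `σ_{n,m} f(p)` is the integral of `f` against a product of Cesàro kernels `K_n`, `K_m`
centred at `p`. With `N = n + 1`, the `(C; -α)` kernel satisfies `|K_n(s)| ≲ N (N s) ^ (α - 1)` on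
`(0, π]`, and its primitive vanishing at `π` is `≲ (N s) ^ (α - 1)` once `N s ≥ 1`. Both follow from
Abel's inequality: the first because `A_l ^ (-α)` decreases in `l`, the second because this sequence
is convex, so that its slopes `(A_l ^ (-α) - A_n ^ (-α)) / (n - l)` decrease too; what is left over
is the Dirichlet kernel.

Fold the integral onto the quadrant `(0, π]²` and subtract there the limit of `f` along each
quadrant; let `g` be the difference. On the box `N s ≤ R`, `M t ≤ R` the function `g` is small,
while the absolute integral of the kernels is `O(R ^ (α + β))`. Where `M t > max R (N s)`, integrate
first in `t`: by the second mean value theorem, bounded variation of the sections leaves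
`∫ N (N s) ^ (α - 1) max(R, N s) ^ (β - 1) ds`, which is of order `R ^ (α + β - 1)` and hence small
for large `R`, since `α + β < 1`. The region `N s > max R (M t)` is symmetric. All bounds depend on
`f` only through the variation of its sections, which makes the convergence uniform. -/

open scoped NNReal

namespace DoubleFourier

/-! ### Abel summation for cosine sums -/

theorem norm_sum_range_succ_smul_le_of_antitoneOn {E : Type*} [SeminormedAddCommGroup E]
    [NormedSpace ℝ E] {a : ℕ → ℝ} {c : ℕ → E} {B : ℝ} {n : ℕ} (ha : AntitoneOn a (Iic n))
    (han : 0 ≤ a n) (hc : ∀ q, ‖∑ l ∈ Finset.range q, c l‖ ≤ B) :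
    ‖∑ l ∈ Finset.range (n + 1), a l • c l‖ ≤ a 0 * B := by
  have hstep : ∀ i ∈ Finset.range n,
      ‖(a (i + 1) - a i) • ∑ l ∈ Finset.range (i + 1), c l‖ ≤ (a i - a (i + 1)) * B := by
    intro i hi
    have hi' : i + 1 ≤ n := Finset.mem_range.1 hi
    have hle : a (i + 1) ≤ a i := ha (show i ≤ n by omega) hi' i.le_succ
    rw [norm_smul, Real.norm_of_nonpos (sub_nonpos.2 hle), neg_sub]
    exact mul_le_mul_of_nonneg_left (hc _) (sub_nonneg.2 hle)
  rw [Finset.sum_range_by_parts, Nat.add_sub_cancel]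
  calc ‖a n • ∑ l ∈ Finset.range (n + 1), c l -
        ∑ i ∈ Finset.range n, (a (i + 1) - a i) • ∑ l ∈ Finset.range (i + 1), c l‖
      ≤ a n * B + ∑ i ∈ Finset.range n, (a i - a (i + 1)) * B := by
        refine (norm_sub_le _ _).trans (add_le_add ?_ (norm_sum_le_of_le _ hstep))
        rw [norm_smul, Real.norm_of_nonneg han]
        exact mul_le_mul_of_nonneg_left (hc _) han
    _ = a 0 * B := by rw [← Finset.sum_mul, Finset.sum_range_sub']; ring

theorem sin_half_mul_sum_cos (φ s : ℝ) (q : ℕ) :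
    2 * Real.sin (s / 2) * ∑ l ∈ Finset.range q, Real.cos (φ - l * s) =
      Real.sin (φ + s / 2) - Real.sin (φ - q * s + s / 2) := by
  have hterm : ∀ l : ℕ, 2 * Real.sin (s / 2) * Real.cos (φ - l * s) =
      Real.sin (φ - l * s + s / 2) - Real.sin (φ - (l + 1 : ℕ) * s + s / 2) := by
    intro l
    rw [show φ - (l + 1 : ℕ) * s + s / 2 = φ - l * s - s / 2 by push_cast; ring,
      Real.sin_add (φ - l * s), Real.sin_sub (φ - l * s)]
    ring
  rw [Finset.mul_sum, Finset.sum_congr rfl fun l _ => hterm l,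
    Finset.sum_range_sub' fun l : ℕ => Real.sin (φ - l * s + s / 2)]
  simp

theorem div_pi_le_sin_half {s : ℝ} (hs0 : 0 ≤ s) (hs1 : s ≤ π) : s / π ≤ Real.sin (s / 2) :=
  calc s / π = 2 / π * (s / 2) := by ring
    _ ≤ Real.sin (s / 2) := Real.mul_le_sin (by linarith) (by linarith)

theorem abs_sum_cos_le {s : ℝ} (hs0 : 0 < s) (hs1 : s ≤ π) (φ : ℝ) (q : ℕ) :
    |∑ l ∈ Finset.range q, Real.cos (φ - l * s)| ≤ π / s := by
  have hs : 0 < s / π := by positivity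
  have hsin : s / π ≤ Real.sin (s / 2) := div_pi_le_sin_half hs0.le hs1
  have htwo : 2 * Real.sin (s / 2) * |∑ l ∈ Finset.range q, Real.cos (φ - l * s)| ≤ 2 := by
    rw [← abs_of_pos (show 0 < 2 * Real.sin (s / 2) by linarith), ← abs_mul,
      sin_half_mul_sum_cos]
    linarith [abs_sub (Real.sin (φ + s / 2)) (Real.sin (φ - q * s + s / 2)),
      Real.abs_sin_le_one (φ + s / 2), Real.abs_sin_le_one (φ - q * s + s / 2)]
  have hone := (mul_le_mul_of_nonneg_right hsin (abs_nonneg _)).trans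
    (show Real.sin (s / 2) * |∑ l ∈ Finset.range q, Real.cos (φ - l * s)| ≤ 1 by linarith)
  rwa [← inv_div s, ← mul_one (s / π)⁻¹, le_inv_mul_iff₀ hs]

theorem abs_sum_mul_cos_le_sum (θ : ℕ → ℝ) {a : ℕ → ℝ} {n : ℕ} (ha : ∀ i < n, 0 ≤ a i) :
    |∑ l ∈ Finset.range n, a l * Real.cos (θ l)| ≤ ∑ l ∈ Finset.range n, a l := by
  refine Finset.abs_sum_le_sum_abs _ _ |>.trans (Finset.sum_le_sum fun l hl => ?_)
  have hl0 := ha l (Finset.mem_range.1 hl)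
  rw [abs_mul, abs_of_nonneg hl0]
  exact mul_le_of_le_one_right hl0 (Real.abs_cos_le_one _)

theorem abs_sum_mul_cos_le {s : ℝ} (hs0 : 0 < s) (hs1 : s ≤ π) (φ : ℝ) {a : ℕ → ℝ} {n L : ℕ}
    (ha : AntitoneOn a (Iio n)) (ha0 : ∀ i < n, 0 ≤ a i) (hL : L < n) :
    |∑ l ∈ Finset.range n, a l * Real.cos (φ - l * s)| ≤
      ∑ l ∈ Finset.range L, a l + a L * (π / s) := by
  obtain ⟨k, rfl⟩ : ∃ k, n = L + (k + 1) := ⟨n - L - 1, by omega⟩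
  rw [Finset.sum_range_add]
  refine (abs_add_le _ _).trans (add_le_add
    (abs_sum_mul_cos_le_sum _ fun i hi => ha0 i (by omega)) ?_)
  refine norm_sum_range_succ_smul_le_of_antitoneOn (a := fun l => a (L + l))
    (c := fun l => Real.cos (φ - (L + l : ℕ) * s)) ?_ (ha0 _ (by omega)) fun q => ?_
  · intro i hi j hj hij
    rw [mem_Iic] at hi hj
    exact ha (mem_Iio.2 (by omega)) (mem_Iio.2 (by omega)) (by omega)
  · simpa only [Real.norm_eq_abs, Nat.cast_add, add_mul, sub_sub] using
      abs_sum_cos_le hs0 hs1 (φ - L * s) q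

/-! ### Cesàro numbers of negative order -/

theorem cesaroNumber_zero (a : ℝ) : cesaroNumber a 0 = 1 := by simp [cesaroNumber]

theorem cesaroNumber_succ (a : ℝ) (k : ℕ) :
    cesaroNumber a (k + 1) = cesaroNumber a k * (1 + a / (k + 1)) := by
  simp only [cesaroNumber, Finset.prod_range_succ, Nat.factorial_succ, Nat.cast_mul, Nat.cast_succ]
  field_simp
  ring

theorem cesaroNumber_order_zero (k : ℕ) : cesaroNumber 0 k = 1 := by
  induction k with
  | zero => exact cesaroNumber_zero 0
  | succ k ih => simp [cesaroNumber_succ, ih]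

theorem cesaroNumber_sub_one (a : ℝ) (k : ℕ) :
    cesaroNumber (a - 1) (k + 1) = cesaroNumber a (k + 1) - cesaroNumber a k := by
  induction k with
  | zero => simp [cesaroNumber_succ, cesaroNumber_zero]
  | succ k ih =>
    rw [cesaroNumber_succ (a - 1), ih, cesaroNumber_succ a (k + 1), cesaroNumber_succ a k]
    push_cast
    field_simp
    ring

theorem add_rpow_le_rpow_mul {x h p : ℝ} (hx : 0 < x) (hh : -x ≤ h) (hp0 : 0 ≤ p) (hp1 : p ≤ 1) :
    (x + h) ^ p ≤ x ^ p * (1 + p * (h / x)) := by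
  have hge : -1 ≤ h / x := by rwa [le_div_iff₀ hx, neg_one_mul]
  calc (x + h) ^ p = x ^ p * (1 + h / x) ^ p := by
        rw [← Real.mul_rpow hx.le (by linarith), mul_one_add, mul_div_cancel₀ h hx.ne']
    _ ≤ x ^ p * (1 + p * (h / x)) := by
        gcongr
        exact rpow_one_add_le_one_add_mul_self hge hp0 hp1

section Neg

variable {α : ℝ}

theorem cesaroNumber_neg_pos (hα1 : α < 1) (k : ℕ) : 0 < cesaroNumber (-α) k := by
  refine div_pos (Finset.prod_pos fun i _ => ?_) (by positivity)
  linarith [(i.cast_nonneg : (0 : ℝ) ≤ i)]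

theorem cesaroNumber_neg_sub_succ (k : ℕ) :
    cesaroNumber (-α) k - cesaroNumber (-α) (k + 1) = α * (cesaroNumber (-α) k / (k + 1)) := by
  rw [cesaroNumber_succ]; ring

theorem antitone_cesaroNumber_neg (hα0 : 0 < α) (hα1 : α < 1) : Antitone (cesaroNumber (-α)) := by
  refine antitone_nat_of_succ_le fun k => sub_nonneg.1 ?_
  have hk := cesaroNumber_neg_pos hα1 k
  rw [cesaroNumber_neg_sub_succ]
  positivity

theorem antitone_cesaroNumber_neg_sub_succ (hα0 : 0 < α) (hα1 : α < 1) :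
    Antitone fun k => cesaroNumber (-α) k - cesaroNumber (-α) (k + 1) := by
  intro i j hij
  have hAij := antitone_cesaroNumber_neg hα0 hα1 hij
  have hi := cesaroNumber_neg_pos hα1 i
  simp only [cesaroNumber_neg_sub_succ]
  gcongr

theorem cesaroNumber_neg_mul_rpow_le_one (hα0 : 0 < α) (hα1 : α < 1) (k : ℕ) :
    cesaroNumber (-α) k * ((k : ℝ) + 1) ^ α ≤ 1 := by
  induction k with
  | zero => simp [cesaroNumber_zero]
  | succ k ih =>
    have hA := (cesaroNumber_neg_pos hα1 (k + 1)).le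
    have hpow : ((k + 1 : ℕ) + 1 : ℝ) ^ α ≤ ((k : ℝ) + 1) ^ α * (1 + α * (1 / (k + 1))) := by
      push_cast
      exact add_rpow_le_rpow_mul (by positivity) (by linarith [(k.cast_nonneg : (0 : ℝ) ≤ k)])
        hα0.le hα1.le
    calc cesaroNumber (-α) (k + 1) * ((k + 1 : ℕ) + 1 : ℝ) ^ α
        ≤ cesaroNumber (-α) (k + 1) * (((k : ℝ) + 1) ^ α * (1 + α * (1 / (k + 1)))) := by gcongr
      _ = cesaroNumber (-α) k * ((k : ℝ) + 1) ^ α * (1 - (α / (k + 1)) ^ 2) := by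
          rw [cesaroNumber_succ]; ring
      _ ≤ cesaroNumber (-α) k * ((k : ℝ) + 1) ^ α * 1 := by
          have hk := cesaroNumber_neg_pos hα1 k
          gcongr
          linarith [sq_nonneg (α / ((k : ℝ) + 1))]
      _ ≤ 1 := by rwa [mul_one]

theorem one_sub_le_cesaroNumber_neg_succ_mul_rpow (hα0 : 0 < α) (hα1 : α < 1) (k : ℕ) :
    1 - α ≤ cesaroNumber (-α) (k + 1) * ((k : ℝ) + 1) ^ α := by
  induction k with
  | zero => simp [cesaroNumber_zero, cesaroNumber_succ, ← sub_eq_add_neg]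
  | succ k ih =>
    have hA := (cesaroNumber_neg_pos hα1 (k + 1)).le
    have hpow := add_rpow_le_rpow_mul (x := (k + 1 : ℕ) + 1) (h := -1) (by positivity)
      (by linarith [((k + 1).cast_nonneg : (0 : ℝ) ≤ (k + 1 : ℕ))]) hα0.le hα1.le
    rw [add_neg_cancel_right] at hpow
    calc 1 - α ≤ cesaroNumber (-α) (k + 1) * ((k + 1 : ℕ) : ℝ) ^ α := by exact_mod_cast ih
      _ ≤ _ := mul_le_mul_of_nonneg_left hpow hA
      _ = cesaroNumber (-α) (k + 1 + 1) * ((k + 1 : ℕ) + 1 : ℝ) ^ α := by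
          rw [cesaroNumber_succ (-α) (k + 1)]; ring

theorem one_div_cesaroNumber_neg_le (hα0 : 0 < α) (hα1 : α < 1) (n : ℕ) :
    1 / cesaroNumber (-α) n ≤ 1 / (1 - α) * ((n : ℝ) + 1) ^ α := by
  have hα2 : 0 < 1 - α := by linarith
  have hA := cesaroNumber_neg_pos hα1 n
  have hlow : 1 - α ≤ cesaroNumber (-α) n * ((n : ℝ) + 1) ^ α :=
    (one_sub_le_cesaroNumber_neg_succ_mul_rpow hα0 hα1 n).trans <| by
      gcongr
      exact antitone_cesaroNumber_neg hα0 hα1 n.le_succ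
  rw [div_mul_eq_mul_div, one_mul, div_le_div_iff₀ hA hα2]
  linarith

theorem sum_cesaroNumber_neg_le (hα0 : 0 < α) (hα1 : α < 1) (L : ℕ) :
    ∑ l ∈ Finset.range L, cesaroNumber (-α) l ≤ (L : ℝ) ^ (1 - α) / (1 - α) := by
  have hα2 : 0 < 1 - α := by linarith
  rw [le_div_iff₀ hα2]
  induction L with
  | zero => simp [Real.zero_rpow hα2.ne']
  | succ L ih =>
    have hL : (0 : ℝ) < L + 1 := by positivity
    have hA : cesaroNumber (-α) L ≤ ((L : ℝ) + 1) ^ (1 - α) / (L + 1) := by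
      rw [← Real.rpow_sub_one hL.ne', sub_sub_cancel_left, Real.rpow_neg hL.le, ← one_div,
        le_div_iff₀ (by positivity)]
      exact cesaroNumber_neg_mul_rpow_le_one hα0 hα1 L
    have hpow := add_rpow_le_rpow_mul (h := -1) (p := 1 - α) hL
      (by linarith [(L.cast_nonneg : (0 : ℝ) ≤ L)]) hα2.le (by linarith)
    rw [add_neg_cancel_right] at hpow
    calc (∑ l ∈ Finset.range (L + 1), cesaroNumber (-α) l) * (1 - α)
        ≤ ((L : ℝ) + 1) ^ (1 - α) * (1 + (1 - α) * (-1 / (L + 1))) +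
            ((L : ℝ) + 1) ^ (1 - α) / (L + 1) * (1 - α) := by
          rw [Finset.sum_range_succ, add_mul]
          exact add_le_add (ih.trans hpow) (mul_le_mul_of_nonneg_right hA hα2.le)
      _ = ((L + 1 : ℕ) : ℝ) ^ (1 - α) := by push_cast; ring

theorem cesaroNumber_neg_floor_le (hα0 : 0 < α) (hα1 : α < 1) {x : ℝ} (hx : 0 < x) :
    cesaroNumber (-α) ⌊x⌋₊ ≤ x ^ (-α) := by
  have hA := cesaroNumber_neg_pos hα1 ⌊x⌋₊
  rw [Real.rpow_neg hx.le, ← one_div, le_div_iff₀ (by positivity)]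
  refine le_trans ?_ (cesaroNumber_neg_mul_rpow_le_one hα0 hα1 ⌊x⌋₊)
  gcongr
  exact (Nat.lt_floor_add_one x).le

theorem sum_range_le_of_le_mul_cesaroNumber_neg (hα0 : 0 < α) (hα1 : α < 1) {b : ℕ → ℝ} {c x : ℝ}
    (hc : 0 ≤ c) {k : ℕ} (hk : k ≤ x) (hb : ∀ l < k, b l ≤ c * cesaroNumber (-α) l) :
    ∑ l ∈ Finset.range k, b l ≤ c * (x ^ (1 - α) / (1 - α)) := by
  have : 0 < 1 - α := by linarith
  calc ∑ l ∈ Finset.range k, b l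
      ≤ c * ∑ l ∈ Finset.range k, cesaroNumber (-α) l := by
        rw [Finset.mul_sum]
        exact Finset.sum_le_sum fun l hl => hb l (Finset.mem_range.1 hl)
    _ ≤ c * ((k : ℝ) ^ (1 - α) / (1 - α)) := by gcongr; exact sum_cesaroNumber_neg_le hα0 hα1 k
    _ ≤ c * (x ^ (1 - α) / (1 - α)) := by gcongr

/-- The split at `l = 1 / (4 s)` balances the trivial bound for the head against Abel's inequality
for the tail; the factor `4` keeps the head away from `n` when `b` has the denominator `n - l`. -/
theorem abs_sum_mul_cos_le_rpow (hα0 : 0 < α) (hα1 : α < 1) {s : ℝ} (hs0 : 0 < s) (hs1 : s ≤ π)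
    {c : ℝ} (hc : 0 ≤ c) {b : ℕ → ℝ} {n : ℕ} (hb : AntitoneOn b (Iio n)) (hb0 : ∀ l < n, 0 ≤ b l)
    (hbc : ∀ l < n, l ≤ 1 / (4 * s) → b l ≤ c * cesaroNumber (-α) l) (φ : ℝ) :
    |∑ l ∈ Finset.range n, b l * Real.cos (φ - l * s)| ≤
      c * ((1 / (1 - α) + 4 * π) * s ^ (α - 1)) := by
  have : 0 < 1 - α := by linarith
  have hpos : 0 < 1 / (4 * s) := by positivity
  have hrpow : (1 / (4 * s)) ^ (1 - α) ≤ s ^ (α - 1) := by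
    rw [← neg_sub α, one_div, Real.inv_rpow (by positivity), Real.rpow_neg (by positivity), inv_inv]
    exact Real.rpow_le_rpow_of_nonpos hs0 (by linarith) (by linarith)
  set L := ⌊1 / (4 * s)⌋₊
  have hle : ∀ l ≤ L, (l : ℝ) ≤ 1 / (4 * s) := fun l hl => (Nat.le_floor_iff hpos.le).1 hl
  have hhead : ∀ k ≤ n, k ≤ L → ∑ l ∈ Finset.range k, b l ≤ c * (s ^ (α - 1) / (1 - α)) :=
    fun k hkn hkL => (sum_range_le_of_le_mul_cesaroNumber_neg hα0 hα1 hc (hle k hkL) fun l hl =>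
      hbc l (by omega) (hle l (by omega))).trans (by gcongr)
  rcases le_or_gt n L with hnL | hLn
  · calc _ ≤ ∑ l ∈ Finset.range n, b l := abs_sum_mul_cos_le_sum _ hb0
      _ ≤ c * (s ^ (α - 1) / (1 - α)) := hhead n le_rfl hnL
      _ = c * ((1 / (1 - α) + 0) * s ^ (α - 1)) := by ring
      _ ≤ c * ((1 / (1 - α) + 4 * π) * s ^ (α - 1)) := by gcongr; positivity
  · have htail : b L * (π / s) ≤ c * (4 * π * s ^ (α - 1)) :=
      calc b L * (π / s) ≤ c * (1 / (4 * s)) ^ (-α) * (π / s) := by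
            gcongr
            exact (hbc L hLn (hle L le_rfl)).trans
              (by gcongr; exact cesaroNumber_neg_floor_le hα0 hα1 hpos)
        _ = c * (4 * π * (1 / (4 * s)) ^ (1 - α)) := by
            rw [show 1 - α = -α + 1 by ring, Real.rpow_add_one hpos.ne']
            field_simp
        _ ≤ c * (4 * π * s ^ (α - 1)) := by gcongr
    calc _ ≤ ∑ l ∈ Finset.range L, b l + b L * (π / s) := abs_sum_mul_cos_le hs0 hs1 φ hb hb0 hLn
      _ ≤ c * (s ^ (α - 1) / (1 - α)) + c * (4 * π * s ^ (α - 1)) :=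
          add_le_add (hhead L hLn.le le_rfl) htail
      _ = _ := by ring

end Neg

theorem antitoneOn_slope_of_antitone_sub_succ {a : ℕ → ℝ} (ha : Antitone fun k => a k - a (k + 1))
    (n : ℕ) : AntitoneOn (fun l : ℕ => (a l - a n) / ((n : ℝ) - l)) (Iio n) := by
  have htel : ∀ i k, a i - a (i + k) ≤ k * (a i - a (i + 1)) := by
    intro i k
    induction k with
    | zero => simp
    | succ k ih =>
      have hik : a (i + k) - a (i + k + 1) ≤ a i - a (i + 1) := ha (Nat.le_add_right i k)
      rw [← add_assoc, Nat.cast_succ]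
      linarith
  refine antitoneOn_of_succ_le ordConnected_Iio fun i _ _ hi => ?_
  obtain ⟨k, rfl⟩ : ∃ k, n = i + 1 + (k + 1) :=
    ⟨n - (i + 2), by have := mem_Iio.1 hi; simp only [Nat.succ_eq_succ] at this; omega⟩
  have hnum := htel (i + 1) (k + 1)
  have hdiff : a (i + 1) - a (i + 1 + 1) ≤ a i - a (i + 1) := ha i.le_succ
  have hden₁ : ((i + 1 + (k + 1) : ℕ) : ℝ) - (i + 1 : ℕ) = k + 1 := by push_cast; ring
  have hden₂ : ((i + 1 + (k + 1) : ℕ) : ℝ) - i = k + 2 := by push_cast; ring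
  simp only [Nat.succ_eq_succ, Nat.succ_eq_add_one, hden₁, hden₂]
  rw [div_le_div_iff₀ (by positivity) (by positivity)]
  push_cast at hnum
  nlinarith [mul_le_mul_of_nonneg_left hdiff (by positivity : (0 : ℝ) ≤ k + 1)]

/-! ### The second mean value theorem for functions of bounded variation -/

theorem abs_sub_le_of_eVariationOn_le {φ : ℝ → ℝ} {s : Set ℝ} {V : ℝ≥0} (hφ : eVariationOn φ s ≤ V)
    {x y : ℝ} (hx : x ∈ s) (hy : y ∈ s) : |φ x - φ y| ≤ V := by
  have hdist := (eVariationOn.edist_le φ hx hy).trans hφ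
  rwa [edist_le_coe, ← NNReal.coe_le_coe, coe_nndist] at hdist

theorem intervalIntegrable_of_boundedVariationOn {φ : ℝ → ℝ} {a b : ℝ}
    (hφ : BoundedVariationOn φ (uIcc a b)) : IntervalIntegrable φ volume a b := by
  obtain ⟨p, q, hp, hq, rfl⟩ := hφ.locallyBoundedVariationOn.exists_monotoneOn_sub_monotoneOn
  exact hp.intervalIntegrable.sub hq.intervalIntegrable

theorem abs_sum_mul_sub_succ_le {φ G : ℕ → ℝ} {B V : ℝ} {n : ℕ} (hG : ∀ k ≤ n, |G k| ≤ B)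
    (hn : G n = 0) (hV : ∑ k ∈ Finset.range n, |φ (k + 1) - φ k| ≤ V) :
    |∑ k ∈ Finset.range n, φ k * (G k - G (k + 1))| ≤ B * (|φ 0| + V) := by
  have hB : 0 ≤ B := (abs_nonneg _).trans (hG 0 n.zero_le)
  have hparts : ∀ q, ∑ k ∈ Finset.range q, φ k * (G k - G (k + 1)) =
      φ 0 * G 0 - φ q * G q + ∑ k ∈ Finset.range q, (φ (k + 1) - φ k) * G (k + 1) := by
    intro q
    induction q with
    | zero => simp
    | succ q ih => rw [Finset.sum_range_succ, ih, Finset.sum_range_succ]; ring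
  have hsum : |∑ k ∈ Finset.range n, (φ (k + 1) - φ k) * G (k + 1)| ≤ V * B :=
    calc _ ≤ ∑ k ∈ Finset.range n, |φ (k + 1) - φ k| * B :=
          Finset.abs_sum_le_sum_abs _ _ |>.trans <| Finset.sum_le_sum fun k hk => by
            rw [abs_mul]
            exact mul_le_mul_of_nonneg_left (hG _ (Finset.mem_range.1 hk)) (abs_nonneg _)
      _ ≤ V * B := by rw [← Finset.sum_mul]; gcongr
  calc _ ≤ |φ 0 * G 0| + |∑ k ∈ Finset.range n, (φ (k + 1) - φ k) * G (k + 1)| := by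
        rw [hparts, hn, mul_zero, sub_zero]
        exact abs_add_le _ _
    _ ≤ |φ 0| * B + V * B := by rw [abs_mul]; gcongr; exact hG 0 n.zero_le
    _ = B * (|φ 0| + V) := by ring

section

variable {φ K : ℝ → ℝ} {V : ℝ≥0} {M : ℝ}

theorem abs_integral_mul_sub_le {a b : ℝ} (hab : a ≤ b) (hK : Continuous K)
    (hM : ∀ t ∈ Icc a b, |K t| ≤ M) (hφ : eVariationOn φ (Icc a b) ≤ V) :
    |(∫ t in a..b, φ t * K t) - φ a * ∫ t in a..b, K t| ≤ V * (M * (b - a)) := by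
  have hint : IntervalIntegrable φ volume a b := intervalIntegrable_of_boundedVariationOn <| by
    rw [uIcc_of_le hab]
    exact ne_top_of_le_ne_top ENNReal.coe_ne_top hφ
  have hKint : IntervalIntegrable K volume a b := hK.intervalIntegrable a b
  rw [← intervalIntegral.integral_const_mul, ← intervalIntegral.integral_sub
    (hint.mul_continuousOn hK.continuousOn) (hKint.const_mul _), ← Real.norm_eq_abs, ← mul_assoc]
  simp_rw [← sub_mul]
  rw [← abs_of_nonneg (sub_nonneg.2 hab)]
  refine intervalIntegral.norm_integral_le_of_norm_le_const fun t ht => ?_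
  rw [uIoc_of_le hab] at ht
  have ht' := Ioc_subset_Icc_self ht
  rw [norm_mul]
  exact mul_le_mul (abs_sub_le_of_eVariationOn_le hφ ht' (left_mem_Icc.2 hab)) (hM t ht')
    (norm_nonneg _) V.coe_nonneg

theorem abs_integral_mul_sub_sum_le {x : ℕ → ℝ} (hx : Monotone x) {h : ℝ} (hh : 0 ≤ h)
    {n : ℕ} (hmesh : ∀ k < n, x (k + 1) - x k ≤ h) (hM0 : 0 ≤ M) (hK : Continuous K)
    (hM : ∀ t ∈ Icc (x 0) (x n), |K t| ≤ M) (hφ : eVariationOn φ (Icc (x 0) (x n)) ≤ V) :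
    |(∫ t in x 0..x n, φ t * K t) -
        ∑ k ∈ Finset.range n, φ (x k) * ∫ t in x k..x (k + 1), K t| ≤ V * (M * h) := by
  have hsub : ∀ k < n, Icc (x k) (x (k + 1)) ⊆ Icc (x 0) (x n) := fun k hk =>
    Icc_subset_Icc (hx k.zero_le) (hx hk)
  have hfin : ∀ k < n, eVariationOn φ (Icc (x k) (x (k + 1))) ≠ ⊤ := fun k hk =>
    ne_top_of_le_ne_top ENNReal.coe_ne_top ((eVariationOn.mono φ (hsub k hk)).trans hφ)
  have hint : ∀ k < n, IntervalIntegrable (fun t => φ t * K t) volume (x k) (x (k + 1)) :=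
    fun k hk => (intervalIntegrable_of_boundedVariationOn
      (by rw [uIcc_of_le (hx k.le_succ)]; exact hfin k hk)).mul_continuousOn hK.continuousOn
  set v : ℕ → ℝ≥0 := fun k => (eVariationOn φ (Icc (x k) (x (k + 1)))).toNNReal with hv
  have hvV : ∑ k ∈ Finset.range n, (v k : ℝ) ≤ V := by
    rw [← eVariationOn.sum' φ hx, ← Finset.sum_congr rfl fun k hk =>
      ENNReal.coe_toNNReal (hfin k (Finset.mem_range.1 hk))] at hφ
    exact_mod_cast hφ
  rw [← intervalIntegral.sum_integral_adjacent_intervals hint, ← Finset.sum_sub_distrib]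
  calc _ ≤ ∑ k ∈ Finset.range n, (v k : ℝ) * (M * h) := by
        refine Finset.abs_sum_le_sum_abs _ _ |>.trans (Finset.sum_le_sum fun k hk => ?_)
        have hk' := Finset.mem_range.1 hk
        refine (abs_integral_mul_sub_le (V := v k) (hx k.le_succ) hK
          (fun t ht => hM t (hsub k hk' ht)) (ENNReal.coe_toNNReal (hfin k hk')).ge).trans ?_
        gcongr
        exact hmesh k hk'
    _ ≤ V * (M * h) := by
        rw [← Finset.sum_mul]
        gcongr

/-- Riemann sums with left tags reduce the claim to summation by parts. -/
theorem abs_integral_mul_le_add_of_eVariationOn_le {a b B : ℝ} (hab : a ≤ b) (hM0 : 0 ≤ M)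
    (hK : Continuous K) (hM : ∀ t ∈ Icc a b, |K t| ≤ M) (hφ : eVariationOn φ (Icc a b) ≤ V)
    (hB : ∀ u ∈ Icc a b, |∫ t in u..b, K t| ≤ B) (n : ℕ) :
    |∫ t in a..b, φ t * K t| ≤
      V * (M * (b - a)) * (1 / ((n : ℝ) + 1)) + B * (|φ a| + V) := by
  have hh0 : 0 ≤ (b - a) / (n + 1) := div_nonneg (sub_nonneg.2 hab) (by positivity)
  set x : ℕ → ℝ := fun k => a + k * ((b - a) / (n + 1)) with hx
  have hmono : Monotone x := fun i j hij => by simp only [hx]; gcongr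
  have hx0 : x 0 = a := by simp [hx]
  have hxn : x (n + 1) = b := by simp only [hx]; push_cast; field_simp; ring
  have hmesh : ∀ k, x (k + 1) - x k = (b - a) / (n + 1) := by
    intro k; simp only [hx]; push_cast; ring
  have hmem : ∀ k ≤ n + 1, x k ∈ Icc a b := fun k hk =>
    ⟨hx0 ▸ hmono k.zero_le, hxn ▸ hmono hk⟩
  have hvar : ∑ k ∈ Finset.range (n + 1), |φ (x (k + 1)) - φ (x k)| ≤ V := by
    have hle := (eVariationOn.sum_le_of_monotoneOn_Iic (hmono.monotoneOn _) hmem).trans hφ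
    simp only [edist_nndist] at hle
    simp only [← Real.dist_eq, ← coe_nndist]
    exact_mod_cast hle
  have hparts := abs_sum_mul_sub_succ_le (φ := fun k => φ (x k))
    (G := fun k => ∫ t in x k..b, K t) (fun k hk => hB _ (hmem k hk)) (by simp [hxn]) hvar
  have hG : ∀ k, (∫ t in x k..b, K t) - ∫ t in x (k + 1)..b, K t = ∫ t in x k..x (k + 1), K t :=
    fun k => sub_eq_of_eq_add (intervalIntegral.integral_add_adjacent_intervals
      (hK.intervalIntegrable _ _) (hK.intervalIntegrable _ _)).symm
  simp only [hG, hx0] at hparts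
  have herr := abs_integral_mul_sub_sum_le (n := n + 1) hmono hh0 (fun k _ => (hmesh k).le) hM0 hK
    (by rwa [hx0, hxn]) (by rwa [hx0, hxn])
  rw [hx0, hxn] at herr
  calc _ ≤ V * (M * ((b - a) / (n + 1))) + B * (|φ a| + V) := by
        linarith [abs_sub_abs_le_abs_sub (∫ t in a..b, φ t * K t)
          (∑ k ∈ Finset.range (n + 1), φ (x k) * ∫ t in x k..x (k + 1), K t)]
    _ = _ := by ring

theorem abs_integral_mul_le_of_eVariationOn_le {a b B : ℝ} (hab : a ≤ b) (hK : Continuous K)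
    (hφ : eVariationOn φ (Icc a b) ≤ V) (hB : ∀ u ∈ Icc a b, |∫ t in u..b, K t| ≤ B) :
    |∫ t in a..b, φ t * K t| ≤ B * (|φ a| + V) := by
  obtain ⟨M, hM⟩ := isCompact_Icc.exists_bound_of_continuousOn (s := Icc a b) hK.continuousOn
  have hM0 : 0 ≤ M := (norm_nonneg _).trans (hM a (left_mem_Icc.2 hab))
  have hlim := (tendsto_one_div_add_atTop_nhds_zero_nat (𝕜 := ℝ)).const_mul (V * (M * (b - a)))
    |>.add_const (B * (|φ a| + V))
  rw [mul_zero, zero_add] at hlim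
  exact ge_of_tendsto' hlim (abs_integral_mul_le_add_of_eVariationOn_le hab hM0 hK hM hφ hB)

end

/-! ### The Cesàro kernel of negative order -/

/-- The `(C; a)` kernel `1 + 2 ∑_{k = 1}^n (A_{n-k}^a / A_n^a) cos (k s)`, written with the
summation index `l = n - k`: the `(C; a)` mean of a Fourier series is the convolution of the
function with this kernel. -/
noncomputable def cesaroKernel (a : ℝ) (n : ℕ) (s : ℝ) : ℝ :=
  1 + 2 / cesaroNumber a n *
    ∑ l ∈ Finset.range n, cesaroNumber a l * Real.cos (n * s - l * s)

theorem continuous_cesaroKernel (a : ℝ) (n : ℕ) : Continuous (cesaroKernel a n) := by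
  unfold cesaroKernel; fun_prop

theorem cesaroKernel_neg (a : ℝ) (n : ℕ) (s : ℝ) : cesaroKernel a n (-s) = cesaroKernel a n s := by
  simp only [cesaroKernel, mul_neg, ← neg_sub', Real.cos_neg]

theorem cesaroKernel_periodic (a : ℝ) (n : ℕ) : Function.Periodic (cesaroKernel a n) (2 * π) := by
  intro s
  unfold cesaroKernel
  congr 2
  refine Finset.sum_congr rfl fun l hl => ?_
  rw [← sub_mul, ← sub_mul, ← Nat.cast_sub (Finset.mem_range.1 hl).le, mul_add,
    Real.cos_add_nat_mul_two_pi]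

theorem integral_cesaroKernel_eq (a : ℝ) (n : ℕ) (u : ℝ) :
    ∫ s in u..π, cesaroKernel a n s = π - u - 2 / cesaroNumber a n *
      ∑ l ∈ Finset.range n, cesaroNumber a l / ((n : ℝ) - l) * Real.sin (n * u - l * u) := by
  have hcos : ∀ l ∈ Finset.range n, ∫ s in u..π, cesaroNumber a l * Real.cos (n * s - l * s) =
      -(cesaroNumber a l / ((n : ℝ) - l) * Real.sin (n * u - l * u)) := by
    intro l hl
    have hln : l < n := Finset.mem_range.1 hl
    have hne : (n : ℝ) - l ≠ 0 := sub_ne_zero.2 (by exact_mod_cast hln.ne')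
    have hsin : Real.sin (((n : ℝ) - l) * π) = 0 := by
      rw [← Nat.cast_sub hln.le]; exact Real.sin_nat_mul_pi _
    simp_rw [← sub_mul]
    rw [intervalIntegral.integral_const_mul, intervalIntegral.integral_comp_mul_left _ hne,
      integral_cos, hsin, smul_eq_mul]
    ring
  unfold cesaroKernel
  rw [intervalIntegral.integral_add (by simp) (Continuous.intervalIntegrable (by fun_prop) _ _),
    intervalIntegral.integral_const_mul, intervalIntegral.integral_finsetSum
      (fun l _ => Continuous.intervalIntegrable (by fun_prop) _ _),
    Finset.sum_congr rfl hcos, Finset.sum_neg_distrib, intervalIntegral.integral_const, smul_eq_mul]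
  ring

theorem integral_cesaroKernel_zero_pi (a : ℝ) (n : ℕ) : ∫ s in 0..π, cesaroKernel a n s = π := by
  simp [integral_cesaroKernel_eq]

theorem integral_cesaroKernel_eq_sub {a : ℝ} {n : ℕ} (ha : cesaroNumber a n ≠ 0) (u : ℝ) :
    ∫ s in u..π, cesaroKernel a n s = (∫ s in u..π, cesaroKernel 0 n s) -
      2 / cesaroNumber a n * ∑ l ∈ Finset.range n,
        (cesaroNumber a l - cesaroNumber a n) / ((n : ℝ) - l) * Real.sin (n * u - l * u) := by
  simp only [integral_cesaroKernel_eq, cesaroNumber_order_zero, sub_sub, Finset.mul_sum]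
  rw [add_assoc, ← Finset.sum_add_distrib]
  congr 2
  refine Finset.sum_congr rfl fun l _ => ?_
  field_simp
  ring

theorem sin_half_mul_cesaroKernel_zero (n : ℕ) (u : ℝ) :
    Real.sin (u / 2) * cesaroKernel 0 n u = Real.sin ((n + 1 / 2) * u) := by
  have hsum := sin_half_mul_sum_cos (n * u) u n
  rw [sub_self, zero_add] at hsum
  simp only [cesaroKernel, cesaroNumber_order_zero, one_mul, div_one]
  rw [show (n + 1 / 2) * u = n * u + u / 2 by ring]
  linarith

theorem sin_half_pos {s : ℝ} (hs0 : 0 < s) (hs1 : s ≤ π) : 0 < Real.sin (s / 2) :=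
  (div_pos hs0 Real.pi_pos).trans_le (div_pi_le_sin_half hs0.le hs1)

theorem inv_sin_half_le {s : ℝ} (hs0 : 0 < s) (hs1 : s ≤ π) : (Real.sin (s / 2))⁻¹ ≤ π / s := by
  rw [← inv_div s]
  exact inv_anti₀ (by positivity) (div_pi_le_sin_half hs0.le hs1)

theorem eVariationOn_Icc_of_antitoneOn {f : ℝ → ℝ} {a b : ℝ} (hab : a ≤ b)
    (hf : AntitoneOn f (Icc a b)) : eVariationOn f (Icc a b) = ENNReal.ofReal (f a - f b) := by
  have hneg : eVariationOn f (Icc a b) = eVariationOn (fun x => -f x) (Icc a b) := by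
    simp only [eVariationOn, edist_neg_neg]
  have heq := hf.neg.eVariationOn_eq (left_mem_Icc.2 hab) (right_mem_Icc.2 hab)
  rwa [Set.inter_self, neg_sub_neg, ← hneg] at heq

theorem eVariationOn_inv_sin_half_le {s : ℝ} (hs0 : 0 < s) (hs1 : s ≤ π) :
    eVariationOn (fun u => (Real.sin (u / 2))⁻¹) (Icc s π) ≤ ENNReal.ofReal (π / s) := by
  have hanti : AntitoneOn (fun u => (Real.sin (u / 2))⁻¹) (Icc s π) := fun u hu v hv huv =>
    inv_anti₀ (sin_half_pos (hs0.trans_le hu.1) hu.2) <|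
      Real.sin_le_sin_of_le_of_le_pi_div_two (by linarith [hu.1, Real.pi_pos]) (by linarith [hv.2])
        (by linarith)
  rw [eVariationOn_Icc_of_antitoneOn hs1 hanti]
  refine ENNReal.ofReal_le_ofReal ?_
  linarith [inv_sin_half_le hs0 hs1, inv_pos.2 (sin_half_pos Real.pi_pos le_rfl)]

theorem abs_integral_sin_mul_le {c : ℝ} (hc : 0 < c) (a b : ℝ) :
    |∫ t in a..b, Real.sin (c * t)| ≤ 2 / c := by
  rw [intervalIntegral.integral_comp_mul_left _ hc.ne', integral_sin, smul_eq_mul, abs_mul,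
    abs_of_pos (inv_pos.2 hc), ← div_eq_inv_mul]
  gcongr
  linarith [abs_sub (Real.cos (c * a)) (Real.cos (c * b)), Real.abs_cos_le_one (c * a),
    Real.abs_cos_le_one (c * b)]

theorem abs_integral_cesaroKernel_zero_le {s : ℝ} (hs0 : 0 < s) (hs1 : s ≤ π) (n : ℕ) :
    |∫ u in s..π, cesaroKernel 0 n u| ≤ 8 * π * (((n : ℝ) + 1) * s)⁻¹ := by
  have hc : (0 : ℝ) < n + 1 / 2 := by positivity
  have hquot : ∀ u ∈ uIcc s π,
      cesaroKernel 0 n u = (Real.sin (u / 2))⁻¹ * Real.sin ((n + 1 / 2) * u) := by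
    intro u hu
    rw [uIcc_of_le hs1] at hu
    rw [← sin_half_mul_cesaroKernel_zero,
      inv_mul_cancel_left₀ (sin_half_pos (hs0.trans_le hu.1) hu.2).ne']
  calc |∫ u in s..π, cesaroKernel 0 n u|
      = |∫ u in s..π, (Real.sin (u / 2))⁻¹ * Real.sin ((n + 1 / 2) * u)| := by
        rw [intervalIntegral.integral_congr hquot]
    _ ≤ 2 / (n + 1 / 2) * (|(Real.sin (s / 2))⁻¹| + (π / s).toNNReal) :=
        abs_integral_mul_le_of_eVariationOn_le hs1 (by fun_prop)
          (eVariationOn_inv_sin_half_le hs0 hs1) fun u _ => abs_integral_sin_mul_le hc u π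
    _ ≤ 4 / (n + 1) * (π / s + π / s) := by
        have hpos := inv_pos.2 (sin_half_pos hs0 hs1)
        rw [Real.coe_toNNReal _ (by positivity), abs_of_pos hpos]
        have hinv := inv_sin_half_le hs0 hs1
        refine mul_le_mul ?_ (by gcongr) (by positivity) (by positivity)
        rw [div_le_div_iff₀ hc (by positivity)]
        linarith [(n.cast_nonneg : (0 : ℝ) ≤ n)]
    _ = 8 * π * (((n : ℝ) + 1) * s)⁻¹ := by field_simp; ring

theorem mul_mul_rpow_sub_one {N s : ℝ} (hN : 0 < N) (hs : 0 ≤ s) (α : ℝ) :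
    N * (N * s) ^ (α - 1) = N ^ α * s ^ (α - 1) := by
  rw [Real.mul_rpow hN.le hs, Real.rpow_sub_one hN.ne']
  field_simp

section Neg

variable {α s : ℝ}

theorem abs_cesaroKernel_neg_le (hα0 : 0 < α) (hα1 : α < 1) (hs0 : 0 < s) (hs1 : s ≤ π) (n : ℕ) :
    |cesaroKernel (-α) n s| ≤ (π + 2 / (1 - α) * (1 / (1 - α) + 4 * π)) *
      (((n : ℝ) + 1) * (((n : ℝ) + 1) * s) ^ (α - 1)) := by
  have : 0 < 1 - α := by linarith
  have hA := cesaroNumber_neg_pos hα1 n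
  have hone : 1 ≤ π * s ^ (α - 1) :=
    calc 1 ≤ π ^ α := Real.one_le_rpow (by linarith [Real.pi_gt_three]) hα0.le
      _ = π * π ^ (α - 1) := by rw [Real.rpow_sub_one Real.pi_ne_zero]; field_simp
      _ ≤ π * s ^ (α - 1) := by
          gcongr ?_ * ?_
          exact Real.rpow_le_rpow_of_nonpos hs0 hs1 (by linarith)
  have hpow : 1 ≤ ((n : ℝ) + 1) ^ α :=
    Real.one_le_rpow (by linarith [(n.cast_nonneg : (0 : ℝ) ≤ n)]) hα0.le
  have hsum : |∑ l ∈ Finset.range n, cesaroNumber (-α) l * Real.cos (n * s - l * s)| ≤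
      1 * ((1 / (1 - α) + 4 * π) * s ^ (α - 1)) :=
    abs_sum_mul_cos_le_rpow hα0 hα1 hs0 hs1 zero_le_one
      ((antitone_cesaroNumber_neg hα0 hα1).antitoneOn _)
      (fun l _ => (cesaroNumber_neg_pos hα1 l).le)
      (fun l _ _ => (one_mul _).ge) _
  calc |cesaroKernel (-α) n s|
      ≤ 1 + 2 * (1 / cesaroNumber (-α) n) *
          |∑ l ∈ Finset.range n, cesaroNumber (-α) l * Real.cos (n * s - l * s)| := by
        refine (abs_add_le _ _).trans_eq ?_
        rw [abs_one, abs_mul, abs_of_pos (div_pos two_pos hA), mul_one_div]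
    _ ≤ ((n : ℝ) + 1) ^ α * (π * s ^ (α - 1)) + 2 * (1 / (1 - α) * ((n : ℝ) + 1) ^ α) *
          (1 * ((1 / (1 - α) + 4 * π) * s ^ (α - 1))) := by
        gcongr
        · exact one_le_mul_of_one_le_of_one_le hpow hone
        · exact one_div_cesaroNumber_neg_le hα0 hα1 n
    _ = _ := by
        rw [mul_mul_rpow_sub_one (by positivity) hs0.le]
        ring

theorem abs_sum_slope_mul_sin_le (hα0 : 0 < α) (hα1 : α < 1) (hs0 : 0 < s) (hs1 : s ≤ π)
    {n : ℕ} (hns : 1 ≤ ((n : ℝ) + 1) * s) :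
    |∑ l ∈ Finset.range n, (cesaroNumber (-α) l - cesaroNumber (-α) n) / ((n : ℝ) - l) *
      Real.sin (n * s - l * s)| ≤ 4 / ((n : ℝ) + 1) * ((1 / (1 - α) + 4 * π) * s ^ (α - 1)) := by
  have hshift : ∀ l : ℕ, Real.sin (n * s - l * s) = Real.cos (n * s - π / 2 - l * s) := by
    intro l
    rw [← Real.cos_sub_pi_div_two, sub_right_comm]
  simp_rw [hshift]
  refine abs_sum_mul_cos_le_rpow hα0 hα1 hs0 hs1 (by positivity)
    (antitoneOn_slope_of_antitone_sub_succ (antitone_cesaroNumber_neg_sub_succ hα0 hα1) n)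
    (fun l hl => div_nonneg (sub_nonneg.2 (antitone_cesaroNumber_neg hα0 hα1 hl.le))
      (sub_nonneg.2 (by exact_mod_cast hl.le))) (fun l hl hls => ?_) _
  have hl4 : (l : ℝ) ≤ (n + 1) / 4 := by
    refine hls.trans ?_
    rw [div_le_div_iff₀ (by positivity) (by norm_num)]
    linarith
  have hn1 : (1 : ℝ) ≤ n := by exact_mod_cast l.zero_le.trans_lt hl
  have hAl := cesaroNumber_neg_pos hα1 l
  have hAn := cesaroNumber_neg_pos hα1 n
  calc (cesaroNumber (-α) l - cesaroNumber (-α) n) / ((n : ℝ) - l)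
      ≤ cesaroNumber (-α) l / (((n : ℝ) + 1) / 4) := by gcongr <;> linarith
    _ = 4 / ((n : ℝ) + 1) * cesaroNumber (-α) l := by field_simp

theorem abs_integral_cesaroKernel_neg_le (hα0 : 0 < α) (hα1 : α < 1) (hs0 : 0 < s) (hs1 : s ≤ π)
    {n : ℕ} (hns : 1 ≤ ((n : ℝ) + 1) * s) :
    |∫ u in s..π, cesaroKernel (-α) n u| ≤
      (8 * π + 8 / (1 - α) * (1 / (1 - α) + 4 * π)) * (((n : ℝ) + 1) * s) ^ (α - 1) := by
  have : 0 < 1 - α := by linarith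
  have hN : (0 : ℝ) < (n : ℝ) + 1 := by positivity
  have hA := cesaroNumber_neg_pos hα1 n
  have hinv : (((n : ℝ) + 1) * s)⁻¹ ≤ (((n : ℝ) + 1) * s) ^ (α - 1) := by
    rw [← Real.rpow_neg_one]
    gcongr
    linarith
  rw [integral_cesaroKernel_eq_sub hA.ne']
  calc _ ≤ |∫ u in s..π, cesaroKernel 0 n u| + 2 * (1 / cesaroNumber (-α) n) *
          |∑ l ∈ Finset.range n, (cesaroNumber (-α) l - cesaroNumber (-α) n) / ((n : ℝ) - l) *
            Real.sin (n * s - l * s)| := by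
        refine (abs_sub _ _).trans_eq ?_
        rw [abs_mul, abs_of_pos (div_pos two_pos hA), mul_one_div]
    _ ≤ 8 * π * (((n : ℝ) + 1) * s) ^ (α - 1) + 2 * (1 / (1 - α) * ((n : ℝ) + 1) ^ α) *
          (4 / ((n : ℝ) + 1) * ((1 / (1 - α) + 4 * π) * s ^ (α - 1))) := by
        gcongr
        · exact (abs_integral_cesaroKernel_zero_le hs0 hs1 n).trans (by gcongr)
        · exact one_div_cesaroNumber_neg_le hα0 hα1 n
        · exact abs_sum_slope_mul_sin_le hα0 hα1 hs0 hs1 hns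
    _ = _ := by
        rw [Real.mul_rpow hN.le hs0.le, Real.rpow_sub_one hN.ne']
        ring

end Neg

/-- The properties of the `(C; -α)` kernel of order `n` that the convergence proof uses, with
`N = n + 1`: the size of `k` at scale `1 / N`, and that of its primitive vanishing at `π`. -/
structure IsKernelBound (α C N : ℝ) (k : ℝ → ℝ) : Prop where
  scale_pos : 0 < N
  continuous : Continuous k
  abs_le : ∀ s ∈ Ioc 0 π, |k s| ≤ C * (N * (N * s) ^ (α - 1))
  abs_integral_le : ∀ s ∈ Ioc 0 π, 1 ≤ N * s → |∫ u in s..π, k u| ≤ C * (N * s) ^ (α - 1)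

theorem exists_isKernelBound_cesaroKernel {α : ℝ} (hα0 : 0 < α) (hα1 : α < 1) :
    ∃ C, ∀ n : ℕ, IsKernelBound α C (n + 1) (cesaroKernel (-α) n) := by
  refine ⟨8 * π + 8 / (1 - α) * (1 / (1 - α) + 4 * π), fun n =>
    { scale_pos := by positivity
      continuous := continuous_cesaroKernel _ n
      abs_le := fun s hs => ?_
      abs_integral_le := fun s hs => abs_integral_cesaroKernel_neg_le hα0 hα1 hs.1 hs.2 }⟩
  have : 0 < 1 - α := by linarith
  have hs0 := hs.1
  refine (abs_cesaroKernel_neg_le hα0 hα1 hs.1 hs.2 n).trans ?_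
  gcongr
  · linarith [Real.pi_pos]
  · norm_num

/-! ### Pairing a function on a square with two kernels -/

section Weight

variable {α β N R : ℝ}

theorem integrableOn_and_setIntegral_rpow_mul_max_rpow (hα0 : 0 < α) (hαβ : α + β < 1)
    (hR : 0 < R) :
    IntegrableOn (fun u => u ^ (α - 1) * max R u ^ (β - 1)) (Ioi 0) ∧
      ∫ u in Ioi 0, u ^ (α - 1) * max R u ^ (β - 1) =
        (1 / α + 1 / (1 - α - β)) * R ^ (α + β - 1) := by
  have hlow : EqOn (fun u => u ^ (α - 1) * max R u ^ (β - 1))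
      (fun u => u ^ (α - 1) * R ^ (β - 1)) (Ioc 0 R) := fun u hu => by
    simp only [max_eq_left hu.2]
  have hhigh : EqOn (fun u => u ^ (α - 1) * max R u ^ (β - 1))
      (fun u => u ^ (α + β - 2)) (Ioi R) := fun u hu => by
    have hu' : R < u := hu
    simp only [max_eq_right hu'.le]
    rw [← Real.rpow_add (hR.trans hu')]
    ring_nf
  have hint_low : IntegrableOn (fun u => u ^ (α - 1) * R ^ (β - 1)) (Ioc 0 R) := by
    rw [← intervalIntegrable_iff_integrableOn_Ioc_of_le hR.le]
    exact (intervalIntegral.intervalIntegrable_rpow' (by linarith)).mul_const _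
  have hint_high : IntegrableOn (fun u : ℝ => u ^ (α + β - 2)) (Ioi R) :=
    integrableOn_Ioi_rpow_of_lt (by linarith) hR
  have hint_low' := hint_low.congr_fun hlow.symm measurableSet_Ioc
  have hint_high' := hint_high.congr_fun hhigh.symm measurableSet_Ioi
  rw [← Ioc_union_Ioi_eq_Ioi hR.le]
  refine ⟨hint_low'.union hint_high', ?_⟩
  rw [setIntegral_union (Ioc_disjoint_Ioi le_rfl) measurableSet_Ioi hint_low' hint_high',
    setIntegral_congr_fun measurableSet_Ioc hlow, setIntegral_congr_fun measurableSet_Ioi hhigh,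
    integral_mul_const, ← intervalIntegral.integral_of_le hR.le,
    integral_rpow (Or.inl (by linarith)), integral_Ioi_rpow_of_lt (by linarith) hR,
    sub_add_cancel, Real.zero_rpow hα0.ne', sub_zero, show α + β - 2 + 1 = α + β - 1 by ring,
    add_mul, show α + β - 1 = α + (β - 1) by ring, Real.rpow_add hR,
    show 1 - α - β = -(α + (β - 1)) by ring, div_neg, neg_mul, neg_div]
  ring

theorem integrableOn_and_setIntegral_mul_rpow_mul_max_rpow (hα0 : 0 < α) (hαβ : α + β < 1)
    (hR : 0 < R) (hN : 0 < N) :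
    IntegrableOn (fun s => N * (N * s) ^ (α - 1) * max R (N * s) ^ (β - 1)) (Ioi 0) ∧
      ∫ s in Ioi 0, N * (N * s) ^ (α - 1) * max R (N * s) ^ (β - 1) =
        (1 / α + 1 / (1 - α - β)) * R ^ (α + β - 1) := by
  obtain ⟨hint, heq⟩ := integrableOn_and_setIntegral_rpow_mul_max_rpow hα0 hαβ hR
  rw [← mul_zero N] at hint heq
  simp_rw [mul_assoc N]
  rw [integral_const_mul, ← heq, ← integral_comp_mul_left_Ioi' _ _ hN, smul_eq_mul]
  exact ⟨((integrableOn_Ioi_comp_mul_left_iff _ _ hN).2 hint).const_mul N, rfl⟩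

theorem integrableOn_and_setIntegral_mul_rpow_sub_one (hα0 : 0 < α) (hR : 0 ≤ R) (hN : 0 < N) :
    IntegrableOn (fun s => N * (N * s) ^ (α - 1)) (Ioc 0 (R / N)) ∧
      ∫ s in Ioc 0 (R / N), N * (N * s) ^ (α - 1) = R ^ α / α := by
  have hRN : 0 ≤ R / N := div_nonneg hR hN.le
  constructor
  · rw [← intervalIntegrable_iff_integrableOn_Ioc_of_le hRN]
    refine IntervalIntegrable.const_mul ?_ N
    have hint := (intervalIntegral.intervalIntegrable_rpow' (a := 0) (b := R)
      (show -1 < α - 1 by linarith)).comp_mul_left (c := N)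
    rwa [zero_div] at hint
  · rw [← intervalIntegral.integral_of_le hRN, intervalIntegral.integral_const_mul,
      intervalIntegral.mul_integral_comp_mul_left (f := fun u => u ^ (α - 1)), mul_zero,
      mul_div_cancel₀ _ hN.ne', integral_rpow (Or.inl (by linarith)), sub_add_cancel,
      Real.zero_rpow hα0.ne', sub_zero]

end Weight

theorem ae_mul_fst_ne_mul_snd (N : ℝ) {M : ℝ} (hM : M ≠ 0) :
    ∀ᵐ p : ℝ × ℝ, N * p.1 ≠ M * p.2 := by
  refine (Measure.ae_prod_iff_ae_ae (measurableSet_eq_fun (by fun_prop) (by fun_prop)).compl).2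
    (Eventually.of_forall fun s => ?_)
  filter_upwards [Measure.ae_ne volume (N * s / M)] with t ht heq
  exact ht (eq_div_of_mul_eq hM (by linarith))

theorem mem_Ioc_div_prod_iff {N M : ℝ} (hN : 0 < N) (hM : 0 < M) {R : ℝ} {p : ℝ × ℝ} :
    p ∈ Ioc 0 (R / N) ×ˢ Ioc 0 (R / M) ↔ (0 < p.1 ∧ N * p.1 ≤ R) ∧ 0 < p.2 ∧ M * p.2 ≤ R := by
  simp only [mem_prod, mem_Ioc, le_div_iff₀' hN, le_div_iff₀' hM]

theorem square_ae_eq_box_union_tails {N M : ℝ} (hN : 0 < N) (hM : 0 < M) {R b : ℝ}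
    (hRN : R / N ≤ b) (hRM : R / M ≤ b) :
    (Ioc 0 b ×ˢ Ioc 0 b : Set (ℝ × ℝ)) =ᵐ[volume] (Ioc 0 (R / N) ×ˢ Ioc 0 (R / M) ∪
      ((Ioc 0 b ×ˢ Ioc 0 b) ∩ {p | max R (N * p.1) < M * p.2} ∪
        (Ioc 0 b ×ˢ Ioc 0 b) ∩ {p | max R (M * p.2) < N * p.1}) : Set (ℝ × ℝ)) := by
  filter_upwards [ae_mul_fst_ne_mul_snd N hM.ne'] with p hp
  refine propext ⟨fun (hpQ : p ∈ Ioc 0 b ×ˢ Ioc 0 b) => ?_, fun h => ?_⟩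
  · rcases le_or_gt (N * p.1) R with h₁ | h₁ <;> rcases le_or_gt (M * p.2) R with h₂ | h₂
    · exact Or.inl ((mem_Ioc_div_prod_iff hN hM).2 ⟨⟨hpQ.1.1, h₁⟩, hpQ.2.1, h₂⟩)
    · exact Or.inr (Or.inl ⟨hpQ, max_lt h₂ (h₁.trans_lt h₂)⟩)
    · exact Or.inr (Or.inr ⟨hpQ, max_lt h₁ (h₂.trans_lt h₁)⟩)
    · rcases lt_or_gt_of_ne hp with h | h
      · exact Or.inr (Or.inl ⟨hpQ, max_lt h₂ h⟩)
      · exact Or.inr (Or.inr ⟨hpQ, max_lt h₁ h⟩)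
  · exact union_subset (prod_mono (Ioc_subset_Ioc_right hRN) (Ioc_subset_Ioc_right hRM))
      (union_subset inter_subset_left inter_subset_left) h

theorem setIntegral_square_eq_box_add_tails {N M : ℝ} (hN : 0 < N) (hM : 0 < M) {R b : ℝ}
    (hRN : R / N ≤ b) (hRM : R / M ≤ b) {F : ℝ × ℝ → ℝ}
    (hF : IntegrableOn F (Ioc 0 b ×ˢ Ioc 0 b)) :
    ∫ p in Ioc 0 b ×ˢ Ioc 0 b, F p = (∫ p in Ioc 0 (R / N) ×ˢ Ioc 0 (R / M), F p) +
      ((∫ p in (Ioc 0 b ×ˢ Ioc 0 b) ∩ {p | max R (N * p.1) < M * p.2}, F p) +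
        ∫ p in (Ioc 0 b ×ˢ Ioc 0 b) ∩ {p | max R (M * p.2) < N * p.1}, F p) := by
  set Q : Set (ℝ × ℝ) := Ioc 0 b ×ˢ Ioc 0 b
  set B : Set (ℝ × ℝ) := Ioc 0 (R / N) ×ˢ Ioc 0 (R / M)
  set T₁ : Set (ℝ × ℝ) := Q ∩ {p | max R (N * p.1) < M * p.2}
  set T₂ : Set (ℝ × ℝ) := Q ∩ {p | max R (M * p.2) < N * p.1}
  have hBQ : B ⊆ Q := prod_mono (Ioc_subset_Ioc_right hRN) (Ioc_subset_Ioc_right hRM)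
  have hT₁ : MeasurableSet T₁ := (measurableSet_Ioc.prod measurableSet_Ioc).inter
    (measurableSet_lt (by fun_prop) (by fun_prop))
  have hT₂ : MeasurableSet T₂ := (measurableSet_Ioc.prod measurableSet_Ioc).inter
    (measurableSet_lt (by fun_prop) (by fun_prop))
  have hdisj : Disjoint T₁ T₂ := disjoint_left.2 fun p h₁ h₂ => by
    have hlt : N * p.1 < M * p.2 := (le_max_right _ _).trans_lt h₁.2
    exact hlt.not_gt ((le_max_right _ _).trans_lt h₂.2)
  have hdisj_box : Disjoint B (T₁ ∪ T₂) := by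
    refine disjoint_left.2 fun p hp hT => ?_
    rw [mem_Ioc_div_prod_iff hN hM] at hp
    rcases hT with ⟨_, hT⟩ | ⟨_, hT⟩
    · exact hp.2.2.not_gt ((le_max_left _ _).trans_lt hT)
    · exact hp.1.2.not_gt ((le_max_left _ _).trans_lt hT)
  rw [setIntegral_congr_set (square_ae_eq_box_union_tails hN hM hRN hRM),
    setIntegral_union hdisj_box (hT₁.union hT₂) (hF.mono_set hBQ)
    (hF.mono_set (union_subset inter_subset_left inter_subset_left)),
    setIntegral_union hdisj hT₂ (hF.mono_set inter_subset_left) (hF.mono_set inter_subset_left)]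

theorem integrableOn_Ioc_prod_mul_of_continuous {a b c d : ℝ} {g : ℝ × ℝ → ℝ}
    (hg : IntegrableOn g (Ioc a b ×ˢ Ioc c d)) {k l : ℝ → ℝ} (hk : Continuous k)
    (hl : Continuous l) :
    IntegrableOn (fun p => g p * (k p.1 * l p.2)) (Ioc a b ×ˢ Ioc c d) :=
  hg.mul_continuousOn_of_subset ((hk.comp continuous_fst).mul
    (hl.comp continuous_snd)).continuousOn (measurableSet_Ioc.prod measurableSet_Ioc)
    (isCompact_Icc.prod isCompact_Icc) (prod_mono Ioc_subset_Icc_self Ioc_subset_Icc_self)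

/-- The sections of `f` over `s`, in either variable, have variation at most `V` on `s`. -/
structure SectionVariationLE (f : ℝ × ℝ → ℝ) (s : Set ℝ) (V : ℝ≥0) : Prop where
  fst : ∀ y ∈ s, eVariationOn (fun x => f (x, y)) s ≤ V
  snd : ∀ x ∈ s, eVariationOn (fun y => f (x, y)) s ≤ V

theorem SectionVariationLE.abs_sub_le {f : ℝ × ℝ → ℝ} {s : Set ℝ} {V : ℝ≥0}
    (hf : SectionVariationLE f s V) {p q : ℝ × ℝ} (hp : p ∈ s ×ˢ s) (hq : q ∈ s ×ˢ s) :
    |f p - f q| ≤ 2 * V := by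
  have h₁ := abs_sub_le_of_eVariationOn_le (hf.fst p.2 hp.2) hp.1 hq.1
  have h₂ := abs_sub_le_of_eVariationOn_le (hf.snd q.1 hq.1) hp.2 hq.2
  linarith [_root_.abs_sub_le (f p) (f (q.1, p.2)) (f q)]

namespace IsKernelBound

variable {α β C D N M : ℝ} {k l : ℝ → ℝ}

theorem const_nonneg (hk : IsKernelBound α C N k) : 0 ≤ C := by
  have hpos := mul_pos hk.scale_pos
    (Real.rpow_pos_of_pos (mul_pos hk.scale_pos Real.pi_pos) (α - 1))
  exact nonneg_of_mul_nonneg_left ((abs_nonneg _).trans (hk.abs_le π ⟨Real.pi_pos, le_rfl⟩)) hpos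

theorem abs_setIntegral_mul_le (hl : IsKernelBound β D M l) (hβ : β ≤ 1) {φ : ℝ → ℝ} {V : ℝ≥0}
    {G : ℝ} (hφ : eVariationOn φ (Icc 0 π) ≤ V) (hG : ∀ t ∈ Ioc 0 π, |φ t| ≤ G) {r : ℝ}
    (hr : 1 ≤ r) : |∫ t in Ioc (r / M) π, φ t * l t| ≤ D * r ^ (β - 1) * (G + V) := by
  have hD := hl.const_nonneg
  have hM := hl.scale_pos
  have hr0 : 0 < r := zero_lt_one.trans_le hr
  have hG0 : 0 ≤ G := (abs_nonneg _).trans (hG π ⟨Real.pi_pos, le_rfl⟩)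
  rcases lt_or_ge π (r / M) with hlt | hle
  · rw [Ioc_eq_empty_of_le hlt.le, setIntegral_empty, abs_zero]
    positivity
  have ha : 0 < r / M := div_pos hr0 hM
  have hprim : ∀ u ∈ Icc (r / M) π, |∫ t in u..π, l t| ≤ D * r ^ (β - 1) := fun u hu => by
    have hru : r ≤ M * u := (div_le_iff₀' hM).1 hu.1
    refine (hl.abs_integral_le u ⟨ha.trans_le hu.1, hu.2⟩ (hr.trans hru)).trans ?_
    exact mul_le_mul_of_nonneg_left (Real.rpow_le_rpow_of_nonpos hr0 hru (by linarith)) hD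
  rw [← intervalIntegral.integral_of_le hle]
  refine (abs_integral_mul_le_of_eVariationOn_le hle hl.continuous
    ((eVariationOn.mono _ (Icc_subset_Icc_left ha.le)).trans hφ) hprim).trans ?_
  gcongr
  exact hG _ ⟨ha, hle⟩

theorem abs_setIntegral_box_le (hk : IsKernelBound α C N k) (hl : IsKernelBound β D M l)
    (hα : 0 < α) (hβ : 0 < β) {R η : ℝ} (hR : 0 ≤ R) (hRN : R / N ≤ π) (hRM : R / M ≤ π)
    {g : ℝ × ℝ → ℝ} (hg : ∀ p ∈ Ioc 0 (R / N) ×ˢ Ioc 0 (R / M), |g p| ≤ η) :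
    |∫ p in Ioc 0 (R / N) ×ˢ Ioc 0 (R / M), g p * (k p.1 * l p.2)| ≤
      C * D * (R ^ α / α * (R ^ β / β)) * η := by
  have hN := hk.scale_pos
  have hM := hl.scale_pos
  have hC := hk.const_nonneg
  obtain ⟨hint₁, heq₁⟩ := integrableOn_and_setIntegral_mul_rpow_sub_one hα hR hN
  obtain ⟨hint₂, heq₂⟩ := integrableOn_and_setIntegral_mul_rpow_sub_one hβ hR hM
  have hbound : ∀ p ∈ Ioc 0 (R / N) ×ˢ Ioc 0 (R / M), ‖g p * (k p.1 * l p.2)‖ ≤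
      C * D * η * (N * (N * p.1) ^ (α - 1) * (M * (M * p.2) ^ (β - 1))) := fun p hp => by
    have hp₁ := hp.1.1
    calc ‖g p * (k p.1 * l p.2)‖
        = |g p| * (|k p.1| * |l p.2|) := by simp only [norm_mul, Real.norm_eq_abs]
      _ ≤ η * (C * (N * (N * p.1) ^ (α - 1)) * (D * (M * (M * p.2) ^ (β - 1)))) := by
          gcongr
          · exact (abs_nonneg _).trans (hg p hp)
          · exact hg p hp
          · exact hk.abs_le _ ⟨hp.1.1, hp.1.2.trans hRN⟩
          · exact hl.abs_le _ ⟨hp.2.1, hp.2.2.trans hRM⟩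
      _ = _ := by ring
  rw [Measure.volume_eq_prod, ← Measure.prod_restrict, ← heq₁, ← heq₂,
    ← integral_prod_mul (fun s => N * (N * s) ^ (α - 1)) (fun t => M * (M * t) ^ (β - 1)),
    mul_right_comm, ← integral_const_mul]
  refine (Real.norm_eq_abs _).symm.trans_le
    (norm_integral_le_of_norm_le ((hint₁.mul_prod hint₂).const_mul _) ?_)
  rw [Measure.prod_restrict]
  exact ae_restrict_of_forall_mem (measurableSet_Ioc.prod measurableSet_Ioc) hbound

theorem norm_setIntegral_indicator_slice_le (hk : IsKernelBound α C N k)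
    (hl : IsKernelBound β D M l) (hβ : β ≤ 1) {R G : ℝ} {V : ℝ≥0} (hR : 1 ≤ R) {g : ℝ × ℝ → ℝ}
    {s : ℝ} (hs : s ∈ Ioc 0 π) (hV : eVariationOn (fun t => g (s, t)) (Icc 0 π) ≤ V)
    (hG : ∀ t ∈ Ioc 0 π, |g (s, t)| ≤ G) :
    ‖∫ t in Ioc 0 π, {p : ℝ × ℝ | max R (N * p.1) < M * p.2}.indicator
      (fun p => g p * (k p.1 * l p.2)) (s, t)‖ ≤
        C * D * (G + V) * (N * (N * s) ^ (α - 1) * max R (N * s) ^ (β - 1)) := by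
  have hN := hk.scale_pos
  have hM := hl.scale_pos
  have hC := hk.const_nonneg
  have hs0 := hs.1
  have hslice : (fun t => {p : ℝ × ℝ | max R (N * p.1) < M * p.2}.indicator
      (fun p => g p * (k p.1 * l p.2)) (s, t)) =
        (Ioi (max R (N * s) / M)).indicator fun t => k s * (g (s, t) * l t) := by
    funext t
    simp only [indicator, mem_ofPred_eq, mem_Ioi, div_lt_iff₀' hM, mul_left_comm]
  have hpos : 0 ≤ max R (N * s) / M :=
    div_nonneg ((zero_le_one.trans hR).trans (le_max_left _ _)) hM.le
  rw [hslice, setIntegral_indicator measurableSet_Ioi, Ioc_inter_Ioi, max_eq_right hpos,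
    integral_const_mul, norm_mul]
  calc ‖k s‖ * ‖∫ t in Ioc (max R (N * s) / M) π, g (s, t) * l t‖
      ≤ C * (N * (N * s) ^ (α - 1)) * (D * max R (N * s) ^ (β - 1) * (G + V)) :=
        mul_le_mul (hk.abs_le s hs)
          (hl.abs_setIntegral_mul_le hβ hV hG (hR.trans (le_max_left _ _)))
          (norm_nonneg _) (by positivity)
    _ = _ := by ring

theorem abs_setIntegral_tail_le (hk : IsKernelBound α C N k) (hl : IsKernelBound β D M l)
    (hα : 0 < α) (hαβ : α + β < 1) {R G : ℝ} {V : ℝ≥0} (hR : 1 ≤ R) {g : ℝ × ℝ → ℝ}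
    (hg : IntegrableOn g (Ioc 0 π ×ˢ Ioc 0 π))
    (hV : ∀ s ∈ Ioc 0 π, eVariationOn (fun t => g (s, t)) (Icc 0 π) ≤ V)
    (hG : ∀ s ∈ Ioc 0 π, ∀ t ∈ Ioc 0 π, |g (s, t)| ≤ G) :
    |∫ p in (Ioc 0 π ×ˢ Ioc 0 π) ∩ {p | max R (N * p.1) < M * p.2}, g p * (k p.1 * l p.2)| ≤
      C * D * (G + V) * ((1 / α + 1 / (1 - α - β)) * R ^ (α + β - 1)) := by
  have hN := hk.scale_pos
  have hC := hk.const_nonneg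
  have hD := hl.const_nonneg
  have hR0 : 0 < R := zero_lt_one.trans_le hR
  have hG0 : 0 ≤ G := (abs_nonneg _).trans
    (hG π ⟨Real.pi_pos, le_rfl⟩ π ⟨Real.pi_pos, le_rfl⟩)
  obtain ⟨hint, heq⟩ := integrableOn_and_setIntegral_mul_rpow_mul_max_rpow hα hαβ hR0 hN
  set T : Set (ℝ × ℝ) := {p | max R (N * p.1) < M * p.2}
  have hT : MeasurableSet T := measurableSet_lt (by fun_prop) (by fun_prop)
  have hF := (integrableOn_Ioc_prod_mul_of_continuous hg hk.continuous hl.continuous).indicator hT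
  rw [← setIntegral_indicator hT, Measure.volume_eq_prod, setIntegral_prod _ hF, ← heq,
    ← integral_const_mul]
  refine (norm_integral_le_of_norm_le ((hint.mono_set fun s hs => hs.1).const_mul _)
    (ae_restrict_of_forall_mem measurableSet_Ioc fun s hs =>
      hk.norm_setIntegral_indicator_slice_le hl (by linarith) hR hs (hV s hs) (hG s hs))).trans ?_
  refine setIntegral_mono_set (hint.const_mul _) ?_
    (Eventually.of_forall fun s (hs : s ∈ Ioc 0 π) => hs.1)
  refine ae_restrict_of_forall_mem measurableSet_Ioi fun s (hs : 0 < s) => ?_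
  have : 0 < max R (N * s) := hR0.trans_le (le_max_left _ _)
  exact mul_nonneg (by positivity) (by positivity)

theorem abs_setIntegral_mul_mul_le (hk : IsKernelBound α C N k) (hl : IsKernelBound β D M l)
    (hα : 0 < α) (hβ : 0 < β) (hαβ : α + β < 1) {R η : ℝ} {V : ℝ≥0} (hR : 1 ≤ R)
    (hRN : R ≤ N) (hRM : R ≤ M) {g : ℝ × ℝ → ℝ} (hg : IntegrableOn g (Ioc 0 π ×ˢ Ioc 0 π))
    (hV : SectionVariationLE g (Icc 0 π) V)
    (hη : ∀ p ∈ Ioc 0 (R / N) ×ˢ Ioc 0 (R / M), |g p| ≤ η) :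
    |∫ p in Ioc 0 π ×ˢ Ioc 0 π, g p * (k p.1 * l p.2)| ≤
      C * D * (R ^ α / α * (R ^ β / β)) * η +
        C * D * (η + 3 * V) * ((1 / α + 1 / β + 2 / (1 - α - β)) * R ^ (α + β - 1)) := by
  have hN := hk.scale_pos
  have hM := hl.scale_pos
  have hR0 : 0 < R := zero_lt_one.trans_le hR
  have hle : ∀ {L : ℝ}, 0 < L → R ≤ L → R / L ≤ π := fun hL hRL =>
    ((div_le_one hL).2 hRL).trans (by linarith [Real.pi_gt_three])
  have hG : ∀ s ∈ Ioc 0 π, ∀ t ∈ Ioc 0 π, |g (s, t)| ≤ η + 2 * V := fun s hs t ht => by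
    have hcorner : (R / N, R / M) ∈ Icc 0 π ×ˢ Icc 0 π :=
      ⟨⟨by positivity, hle hN hRN⟩, by positivity, hle hM hRM⟩
    have hosc := hV.abs_sub_le (p := (s, t)) ⟨Ioc_subset_Icc_self hs, Ioc_subset_Icc_self ht⟩
      hcorner
    have hsmall := hη (R / N, R / M)
      ⟨right_mem_Ioc.2 (by positivity), right_mem_Ioc.2 (by positivity)⟩
    linarith [abs_sub_abs_le_abs_sub (g (s, t)) (g (R / N, R / M))]
  have hbox := hk.abs_setIntegral_box_le hl hα hβ hR0.le (hle hN hRN) (hle hM hRM) hη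
  have htail := hk.abs_setIntegral_tail_le hl hα hαβ hR hg
    (fun s hs => hV.snd s (Ioc_subset_Icc_self hs)) hG
  have hswap : ∫ p in (Ioc 0 π ×ˢ Ioc 0 π) ∩ {p | max R (M * p.2) < N * p.1},
      g p * (k p.1 * l p.2) = ∫ p in (Ioc 0 π ×ˢ Ioc 0 π) ∩ {p | max R (M * p.1) < N * p.2},
        (g ∘ Prod.swap) p * (l p.1 * k p.2) := by
    rw [Measure.volume_eq_prod, ← Measure.measurePreserving_swap.setIntegral_preimage_emb
      MeasurableEquiv.prodComm.measurableEmbedding, preimage_inter, preimage_swap_prod]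
    simp only [mul_comm (k _), Function.comp_apply, preimage_ofPred_eq, Prod.fst_swap,
      Prod.snd_swap]
  have htail_swap := hl.abs_setIntegral_tail_le hk hβ (by linarith : β + α < 1) hR
    (g := g ∘ Prod.swap) hg.swap (fun t ht => hV.fst t (Ioc_subset_Icc_self ht))
    fun t ht s hs => hG s hs t ht
  rw [setIntegral_square_eq_box_add_tails hN hM (hle hN hRN) (hle hM hRM)
    (integrableOn_Ioc_prod_mul_of_continuous hg hk.continuous hl.continuous), hswap]
  calc _ ≤ _ := (abs_add_le _ _).trans
        (add_le_add hbox ((abs_add_le _ _).trans (add_le_add htail htail_swap)))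
    _ = _ := by
      rw [add_comm β α, sub_right_comm 1 β α]
      ring

end IsKernelBound

/-! ### Integral representation of the Cesàro means -/

theorem sum_Icc_exp_eq (i : ℕ) (s : ℝ) :
    ∑ k ∈ Finset.Icc (-(i : ℤ)) i, Complex.exp (Complex.I * k * s) =
      ((1 + 2 * ∑ k ∈ Finset.range i, Real.cos ((k + 1 : ℕ) * s) : ℝ) : ℂ) := by
  induction i with
  | zero => simp
  | succ i ih =>
    have hsucc := Finset.sum_Icc_succ_eq_add_endpoints
      (fun k : ℤ => Complex.exp (Complex.I * k * s)) (N := i)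
    push_cast at hsucc ⊢
    rw [hsucc, ih, Finset.sum_range_succ]
    push_cast
    rw [Complex.cos, show Complex.I * -((i : ℂ) + 1) * s = -((i + 1) * s) * Complex.I by ring,
      show Complex.I * ((i : ℂ) + 1) * s = ((i + 1) * s) * Complex.I by ring]
    ring

theorem sum_cesaroNumber_sub_one_mul (a : ℝ) (e : ℕ → ℝ) (q : ℕ) :
    ∑ j ∈ Finset.range (q + 1), cesaroNumber (a - 1) j * e j =
      cesaroNumber a q * e q + ∑ j ∈ Finset.range q, cesaroNumber a j * (e j - e (j + 1)) := by
  induction q with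
  | zero => simp [cesaroNumber_zero]
  | succ q ih =>
    rw [Finset.sum_range_succ, ih, cesaroNumber_sub_one, Finset.sum_range_succ _ q]
    ring

theorem sum_cesaroNumber_sub_one_mul_sum_exp (a : ℝ) (n : ℕ) (s : ℝ) :
    ∑ i ∈ Finset.range (n + 1), (cesaroNumber (a - 1) (n - i) : ℂ) *
      ∑ k ∈ Finset.Icc (-(i : ℤ)) i, Complex.exp (Complex.I * k * s) =
        ((cesaroNumber a n + 2 * ∑ l ∈ Finset.range n,
          cesaroNumber a l * Real.cos (n * s - l * s) : ℝ) : ℂ) := by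
  set D : ℕ → ℝ := fun i => 1 + 2 * ∑ k ∈ Finset.range i, Real.cos ((k + 1 : ℕ) * s) with hD
  have hD_sub : ∀ j ∈ Finset.range n, cesaroNumber a j * (D (n - j) - D (n - (j + 1))) =
      2 * (cesaroNumber a j * Real.cos (n * s - j * s)) := by
    intro j hj
    have hjn := Finset.mem_range.1 hj
    have hsucc : n - j = n - (j + 1) + 1 := by omega
    have hcast : ((n - (j + 1) + 1 : ℕ) : ℝ) * s = n * s - j * s := by
      rw [← hsucc, Nat.cast_sub hjn.le, sub_mul]
    rw [hsucc]
    simp only [hD, Finset.sum_range_succ, hcast]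
    ring
  simp_rw [sum_Icc_exp_eq]
  norm_cast
  calc ∑ i ∈ Finset.range (n + 1), cesaroNumber (a - 1) (n - i) * D i
      = ∑ j ∈ Finset.range (n + 1), cesaroNumber (a - 1) j * D (n - j) := by
        rw [← Finset.sum_range_reflect]
        refine Finset.sum_congr rfl fun j hj => ?_
        rw [Nat.add_sub_cancel, Nat.sub_sub_self (Finset.mem_range_succ_iff.1 hj)]
    _ = cesaroNumber a n + 2 * ∑ l ∈ Finset.range n,
          cesaroNumber a l * Real.cos (n * s - l * s) := by
        rw [sum_cesaroNumber_sub_one_mul, Finset.sum_congr rfl hD_sub, ← Finset.mul_sum]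
        simp [hD]

theorem sum_cesaroNumber_mul_sum_exp {a : ℝ} {n : ℕ} (hn : cesaroNumber a n ≠ 0) (s : ℝ) :
    ∑ i ∈ Finset.range (n + 1), 1 / (cesaroNumber a n : ℂ) * cesaroNumber (a - 1) (n - i) *
      ∑ k ∈ Finset.Icc (-(i : ℤ)) i, Complex.exp (Complex.I * k * s) =
        (cesaroKernel a n s : ℂ) := by
  simp_rw [mul_assoc (1 / (cesaroNumber a n : ℂ))]
  rw [← Finset.mul_sum, sum_cesaroNumber_sub_one_mul_sum_exp]
  norm_cast
  unfold cesaroKernel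
  field_simp

theorem sum_sum_integral_mul {ι κ : Type*} {Q : Set (ℝ × ℝ)} (hQ : IsCompact Q)
    {f : ℝ × ℝ → ℂ} (hf : IntegrableOn f Q) (s : Finset ι) (t : Finset κ) {u : ι → ℝ → ℂ}
    {v : κ → ℝ → ℂ} (hu : ∀ i ∈ s, Continuous (u i)) (hv : ∀ j ∈ t, Continuous (v j)) :
    ∑ i ∈ s, ∑ j ∈ t, ∫ p in Q, f p * (u i p.1 * v j p.2) =
      ∫ p in Q, f p * ((∑ i ∈ s, u i p.1) * ∑ j ∈ t, v j p.2) := by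
  have hint : ∀ i ∈ s, ∀ j ∈ t, IntegrableOn (fun p => f p * (u i p.1 * v j p.2)) Q :=
    fun i hi j hj => hf.mul_continuousOn (((hu i hi).comp continuous_fst).mul
      ((hv j hj).comp continuous_snd)).continuousOn hQ
  simp_rw [Finset.sum_mul_sum, Finset.mul_sum]
  rw [integral_finsetSum _ fun i hi => integrable_finsetSum _ fun j hj => hint i hi j hj]
  exact Finset.sum_congr rfl fun i hi => (integral_finsetSum _ fun j hj => hint i hi j hj).symm

theorem isCompact_square : IsCompact (Icc 0 (2 * π) ×ˢ Icc 0 (2 * π)) :=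
  isCompact_Icc.prod isCompact_Icc

theorem IsL1.integrableOn_ofReal {f : ℝ × ℝ → ℝ} (hf : IsL1 f) (c : ℂ) :
    IntegrableOn (fun p => c * (f p : ℂ)) (Icc 0 (2 * π) ×ˢ Icc 0 (2 * π)) :=
  (Integrable.ofReal hf).const_mul c

theorem exp_I_mul_sub (k : ℤ) (x w : ℝ) : Complex.exp (Complex.I * k * (x - w : ℝ)) =
    Complex.exp (Complex.I * k * x) * Complex.exp (-(Complex.I * k * (w : ℂ))) := by
  rw [← Complex.exp_add]
  push_cast
  ring_nf

theorem partialSum_eq_integral {f : ℝ × ℝ → ℝ} (hf : IsL1 f) (i j : ℕ) (x y : ℝ) :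
    partialSum f i j (x, y) = ∫ p in Icc 0 (2 * π) ×ˢ Icc 0 (2 * π),
      (1 / (4 * (π : ℂ) ^ 2) * (f p : ℂ)) *
        ((∑ k ∈ Finset.Icc (-(i : ℤ)) i, Complex.exp (Complex.I * k * (x - p.1 : ℝ))) *
          ∑ l ∈ Finset.Icc (-(j : ℤ)) j, Complex.exp (Complex.I * l * (y - p.2 : ℝ))) := by
  rw [← sum_sum_integral_mul isCompact_square (hf.integrableOn_ofReal _) _ _
    (u := fun (k : ℤ) w => Complex.exp (Complex.I * k * (x - w : ℝ)))
    (v := fun (l : ℤ) w => Complex.exp (Complex.I * l * (y - w : ℝ)))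
    (fun k _ => by fun_prop) (fun l _ => by fun_prop)]
  unfold partialSum fourierCoeff₂
  refine Finset.sum_congr rfl fun k _ => Finset.sum_congr rfl fun l _ => ?_
  rw [mul_assoc, mul_assoc, ← integral_mul_const, ← integral_const_mul]
  simp only [exp_I_mul_sub]
  congr 1 with p
  ring

theorem cesaroMean_eq_integral {f : ℝ × ℝ → ℝ} (hf : IsL1 f) {a b : ℝ} {n m : ℕ}
    (hn : cesaroNumber a n ≠ 0) (hm : cesaroNumber b m ≠ 0) (x y : ℝ) :
    cesaroMean a b f n m (x, y) = ((1 / (4 * π ^ 2) * ∫ p in Icc 0 (2 * π) ×ˢ Icc 0 (2 * π),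
      f p * (cesaroKernel a n (x - p.1) * cesaroKernel b m (y - p.2)) : ℝ) : ℂ) := by
  have hsum := sum_sum_integral_mul isCompact_square
    (hf.integrableOn_ofReal (1 / (4 * (π : ℂ) ^ 2))) (Finset.range (n + 1)) (Finset.range (m + 1))
    (u := fun i w => 1 / (cesaroNumber a n : ℂ) * cesaroNumber (a - 1) (n - i) *
      ∑ k ∈ Finset.Icc (-(i : ℤ)) i, Complex.exp (Complex.I * k * (x - w : ℝ)))
    (v := fun j w => 1 / (cesaroNumber b m : ℂ) * cesaroNumber (b - 1) (m - j) *
      ∑ l ∈ Finset.Icc (-(j : ℤ)) j, Complex.exp (Complex.I * l * (y - w : ℝ)))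
    (fun i _ => by fun_prop) (fun j _ => by fun_prop)
  simp_rw [sum_cesaroNumber_mul_sum_exp hn, sum_cesaroNumber_mul_sum_exp hm] at hsum
  calc cesaroMean a b f n m (x, y)
      = ∫ p in Icc 0 (2 * π) ×ˢ Icc 0 (2 * π), (1 / (4 * (π : ℂ) ^ 2) * (f p : ℂ)) *
          ((cesaroKernel a n (x - p.1) : ℂ) * (cesaroKernel b m (y - p.2) : ℂ)) := by
        unfold cesaroMean
        rw [Finset.mul_sum, ← hsum]
        refine Finset.sum_congr rfl fun i _ => ?_
        rw [Finset.mul_sum]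
        refine Finset.sum_congr rfl fun j _ => ?_
        rw [partialSum_eq_integral hf, ← integral_const_mul, ← integral_const_mul]
        congr 1 with p
        ring
    _ = _ := by
        rw [← integral_const_mul, ← integral_complex_ofReal]
        congr 1 with p
        push_cast
        ring

/-! ### Folding the period square onto a quadrant -/

/-- The point obtained from `p` by the displacement `u` in the quadrant with signs `ε`. -/
def quadrantPoint (p : ℝ × ℝ) (ε : ℤˣ × ℤˣ) (u : ℝ × ℝ) : ℝ × ℝ :=
  (p.1 + ε.1 • u.1, p.2 + ε.2 • u.2)

theorem measurableEmbedding_add_units_smul (x : ℝ) (ε : ℤˣ) :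
    MeasurableEmbedding fun s : ℝ => x + ε • s :=
  (measurableEmbedding_addLeft x).comp (measurableEmbedding_const_smul ε)

theorem measurableEmbedding_quadrantPoint (p : ℝ × ℝ) (ε : ℤˣ × ℤˣ) :
    MeasurableEmbedding (quadrantPoint p ε) :=
  (measurableEmbedding_add_units_smul p.1 ε.1).prodMap
    (measurableEmbedding_add_units_smul p.2 ε.2)

theorem map_add_left_restrict_Ioc (x a : ℝ) :
    (volume.restrict (Ioc 0 a)).map (x + ·) = volume.restrict (Ioc x (x + a)) := by
  have hpre : (x + ·) ⁻¹' Ioc x (x + a) = Ioc 0 a := by simp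
  rw [← hpre]
  exact ((measurePreserving_add_left volume x).restrict_preimage measurableSet_Ioc).map_eq

theorem map_sub_left_restrict_Ioc (x a : ℝ) :
    (volume.restrict (Ioc 0 a)).map (x - ·) = volume.restrict (Ioc (x - a) x) := by
  have hpre : (x - ·) ⁻¹' Ico (x - a) x = Ioc 0 a := by simp
  rw [← hpre, ← restrict_Ico_eq_restrict_Ioc]
  exact ((Measure.measurePreserving_sub_left volume x).restrict_preimage measurableSet_Ico).map_eq

theorem restrict_Ioc_eq_sum_map {a : ℝ} (ha : 0 ≤ a) (x : ℝ) :
    volume.restrict (Ioc (x - a) (x - a + 2 * a)) =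
      Measure.sum fun ε : ℤˣ => (volume.restrict (Ioc 0 a)).map fun s => x + ε • s := by
  rw [show x - a + 2 * a = x + a by ring, ← Ioc_union_Ioc_eq_Ioc (b := x) (by linarith)
    (by linarith), Measure.restrict_union (Ioc_disjoint_Ioc_of_le le_rfl) measurableSet_Ioc,
    Measure.sum_fintype, ← map_add_left_restrict_Ioc, ← map_sub_left_restrict_Ioc, add_comm]
  simp [sub_eq_add_neg]

theorem restrict_square_eq_sum_map {a : ℝ} (ha : 0 ≤ a) (p : ℝ × ℝ) :
    volume.restrict (Ioc (p.1 - a) (p.1 - a + 2 * a) ×ˢ Ioc (p.2 - a) (p.2 - a + 2 * a)) =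
      Measure.sum fun ε : ℤˣ × ℤˣ =>
        (volume.restrict (Ioc 0 a ×ˢ Ioc 0 a)).map (quadrantPoint p ε) := by
  simp only [Measure.volume_eq_prod, ← Measure.prod_restrict]
  rw [restrict_Ioc_eq_sum_map ha, restrict_Ioc_eq_sum_map ha, Measure.prod_sum]
  exact congrArg Measure.sum (funext fun ε => Measure.map_prod_map _ _
    (measurableEmbedding_add_units_smul p.1 ε.1).measurable
    (measurableEmbedding_add_units_smul p.2 ε.2).measurable)

instance countable_addSubgroup_prod {G H : Type*} [AddGroup G] [AddGroup H] (A : AddSubgroup G)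
    (B : AddSubgroup H) [Countable A] [Countable B] : Countable (A.prod B) :=
  (AddSubgroup.prodEquiv A B).toEquiv.countable_iff.2 inferInstance

theorem isAddFundamentalDomain_Ioc_prod {S T : ℝ} (hS : 0 < S) (hT : 0 < T) (a b : ℝ) :
    IsAddFundamentalDomain ((AddSubgroup.zmultiples S).prod (AddSubgroup.zmultiples T))
      (Ioc a (a + S) ×ˢ Ioc b (b + T)) := by
  refine .mk' (measurableSet_Ioc.prod measurableSet_Ioc).nullMeasurableSet fun p => ?_
  obtain ⟨m, hm, hm_unique⟩ := existsUnique_add_zsmul_mem_Ioc hS p.1 a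
  obtain ⟨n, hn, hn_unique⟩ := existsUnique_add_zsmul_mem_Ioc hT p.2 b
  refine ⟨⟨(m • S, n • T), ⟨m, rfl⟩, n, rfl⟩, ?_, ?_⟩
  · exact ⟨by simpa [add_comm] using hm, by simpa [add_comm] using hn⟩
  · rintro ⟨⟨c, d⟩, hc, hd⟩ h
    obtain ⟨m', rfl⟩ : ∃ m' : ℤ, m' • S = c := hc
    obtain ⟨n', rfl⟩ : ∃ n' : ℤ, n' • T = d := hd
    have hm' : m' = m := hm_unique m' (by simpa [add_comm] using h.1)
    have hn' : n' = n := hn_unique n' (by simpa [add_comm] using h.2)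
    simp [hm', hn']

section Biperiodic

variable {f : ℝ × ℝ → ℝ}

theorem IsBiperiodic.vadd_eq (hper : IsBiperiodic f)
    (c : (AddSubgroup.zmultiples (2 * π)).prod (AddSubgroup.zmultiples (2 * π))) (p : ℝ × ℝ) :
    f (c +ᵥ p) = f p := by
  obtain ⟨⟨c, d⟩, hc, hd⟩ := c
  obtain ⟨m, rfl⟩ : ∃ m : ℤ, m • (2 * π) = c := hc
  obtain ⟨n, rfl⟩ : ∃ n : ℤ, n • (2 * π) = d := hd
  have hfst := Function.Periodic.zsmul (f := fun x => f (x, n • (2 * π) + p.2))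
    (fun x => hper.1 x _) m p.1
  have hsnd := Function.Periodic.zsmul (f := fun y => f (p.1, y)) (fun y => hper.2 p.1 y) n p.2
  rw [add_comm p.1] at hfst
  rw [add_comm p.2] at hsnd
  exact hfst.trans hsnd

theorem restrict_square_eq_restrict_Ioc_prod :
    volume.restrict (Icc 0 (2 * π) ×ˢ Icc 0 (2 * π)) =
      volume.restrict (Ioc 0 (0 + 2 * π) ×ˢ Ioc 0 (0 + 2 * π)) := by
  simp only [Measure.volume_eq_prod, ← Measure.prod_restrict, zero_add,
    restrict_Ioc_eq_restrict_Icc]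

theorem IsBiperiodic.integrable_sum_map (hper : IsBiperiodic f) (hf : IsL1 f) (p : ℝ × ℝ) :
    Integrable f (Measure.sum fun ε : ℤˣ × ℤˣ =>
      (volume.restrict (Ioc 0 π ×ˢ Ioc 0 π)).map (quadrantPoint p ε)) := by
  rw [← restrict_square_eq_sum_map Real.pi_pos.le]
  rw [IsL1, IntegrableOn, restrict_square_eq_restrict_Ioc_prod] at hf
  exact ((isAddFundamentalDomain_Ioc_prod Real.two_pi_pos Real.two_pi_pos _ _).integrableOn_iff
    (isAddFundamentalDomain_Ioc_prod Real.two_pi_pos Real.two_pi_pos 0 0) hper.vadd_eq).2 hf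

theorem IsBiperiodic.integrableOn_comp_quadrantPoint (hper : IsBiperiodic f) (hf : IsL1 f)
    (p : ℝ × ℝ) (ε : ℤˣ × ℤˣ) :
    IntegrableOn (f ∘ quadrantPoint p ε) (Ioc 0 π ×ˢ Ioc 0 π) :=
  (measurableEmbedding_quadrantPoint p ε).integrable_map_iff.1
    ((hper.integrable_sum_map hf p).mono_measure (Measure.le_sum _ ε))

theorem IsBiperiodic.setIntegral_square_eq_sum (hper : IsBiperiodic f) (hf : IsL1 f)
    (p : ℝ × ℝ) :
    ∫ u in Icc 0 (2 * π) ×ˢ Icc 0 (2 * π), f u =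
      ∑ ε : ℤˣ × ℤˣ, ∫ u in Ioc 0 π ×ˢ Ioc 0 π, f (quadrantPoint p ε u) := by
  rw [restrict_square_eq_restrict_Ioc_prod,
    (isAddFundamentalDomain_Ioc_prod Real.two_pi_pos Real.two_pi_pos 0 0).setIntegral_eq
    (isAddFundamentalDomain_Ioc_prod Real.two_pi_pos Real.two_pi_pos (p.1 - π) (p.2 - π))
    hper.vadd_eq, restrict_square_eq_sum_map Real.pi_pos.le,
    integral_sum_measure (hper.integrable_sum_map hf p), tsum_fintype]
  exact Finset.sum_congr rfl fun ε _ => (measurableEmbedding_quadrantPoint p ε).integral_map _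

end Biperiodic

/-! ### Variation of the sections on a quadrant -/

section Periodic

variable {φ : ℝ → ℝ} {T : ℝ}

theorem eVariationOn_sub_const (φ : ℝ → ℝ) (q : ℝ) (s : Set ℝ) :
    eVariationOn (fun t => φ t - q) s = eVariationOn φ s := by
  simp only [eVariationOn, edist_sub_right]

theorem eVariationOn_Icc_add_zsmul (hφ : Function.Periodic φ T) (k : ℤ) (a b : ℝ) :
    eVariationOn φ (Icc (a + k • T) (b + k • T)) = eVariationOn φ (Icc a b) := by
  rw [← image_add_const_Icc, ← eVariationOn.comp_eq_of_monotoneOn _ _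
    fun u _ v _ huv => add_le_add_left huv _]
  congr 1 with u
  exact hφ.zsmul k u

theorem eVariationOn_Icc_add_Icc (φ : ℝ → ℝ) {a b c : ℝ} (hab : a ≤ b) (hbc : b ≤ c) :
    eVariationOn φ (Icc a b) + eVariationOn φ (Icc b c) = eVariationOn φ (Icc a c) := by
  simpa using eVariationOn.Icc_add_Icc φ (s := univ) hab hbc (mem_univ b)

theorem eVariationOn_Icc_add_period (hφ : Function.Periodic φ T) (hT : 0 < T) (a : ℝ) :
    eVariationOn φ (Icc a (a + T)) = eVariationOn φ (Icc 0 T) := by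
  obtain ⟨k, ⟨hr₀, hrT⟩, -⟩ := existsUnique_add_zsmul_mem_Ico hT a 0
  rw [zero_add] at hrT
  set r := a + k • T
  calc eVariationOn φ (Icc a (a + T)) = eVariationOn φ (Icc r (T + r)) := by
        rw [← eVariationOn_Icc_add_zsmul hφ k, add_right_comm, add_comm T]
    _ = eVariationOn φ (Icc r T) + eVariationOn φ (Icc T (T + r)) :=
        (eVariationOn_Icc_add_Icc φ hrT.le (by linarith)).symm
    _ = eVariationOn φ (Icc r T) + eVariationOn φ (Icc 0 r) := by
        have h := eVariationOn_Icc_add_zsmul hφ 1 0 r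
        rw [one_smul, zero_add, add_comm r] at h
        rw [h]
    _ = eVariationOn φ (Icc 0 T) := by rw [add_comm, eVariationOn_Icc_add_Icc φ hr₀ hrT.le]

theorem eVariationOn_comp_add_units_smul_le (hφ : Function.Periodic φ (2 * T)) (hT : 0 < T)
    (x : ℝ) (ε : ℤˣ) :
    eVariationOn (fun s => φ (x + ε • s)) (Icc 0 T) ≤ eVariationOn φ (Icc 0 (2 * T)) := by
  rw [← eVariationOn_Icc_add_period hφ (by positivity) (x - T)]
  rcases Int.units_eq_one_or ε with rfl | rfl
  · simp only [one_smul]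
    exact eVariationOn.comp_le_of_monotoneOn φ _ (fun u _ v _ huv => add_le_add_right huv x)
      fun s hs => ⟨by linarith [hs.1], by linarith [hs.2]⟩
  · simp only [Units.neg_smul, one_smul, ← sub_eq_add_neg]
    exact eVariationOn.comp_le_of_antitoneOn φ _ (fun u _ v _ huv => sub_le_sub_left huv x)
      fun s hs => ⟨by linarith [hs.2], by linarith [hs.1]⟩

end Periodic

section SectionVariationLE

variable {f : ℝ × ℝ → ℝ} {s : Set ℝ} {V : ℝ≥0}

theorem SectionVariationLE.sub_const (hf : SectionVariationLE f s V) (q : ℝ) :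
    SectionVariationLE (fun p => f p - q) s V where
  fst y hy := (eVariationOn_sub_const _ q s).trans_le (hf.fst y hy)
  snd x hx := (eVariationOn_sub_const _ q s).trans_le (hf.snd x hx)

theorem IsPBV.exists_sectionVariationLE (hf : IsPBV f) :
    ∃ V : ℝ≥0, SectionVariationLE f (Icc 0 (2 * π)) V := by
  obtain ⟨V, hV⟩ := WithTop.ne_top_iff_exists.1 hf.ne
  refine ⟨V, fun y hy => ?_, fun x hx => ?_⟩ <;> refine le_trans ?_ hV.ge
  · exact (le_iSup₂ (f := fun y (_ : y ∈ Icc 0 (2 * π)) =>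
      eVariationOn (fun x => f (x, y)) (Icc 0 (2 * π))) y hy).trans le_self_add
  · exact (le_iSup₂ (f := fun x (_ : x ∈ Icc 0 (2 * π)) =>
      eVariationOn (fun y => f (x, y)) (Icc 0 (2 * π))) x hx).trans le_add_self

theorem SectionVariationLE.comp_quadrantPoint (hf : SectionVariationLE f (Icc 0 (2 * π)) V)
    (hper : IsBiperiodic f) (p : ℝ × ℝ) (ε : ℤˣ × ℤˣ) :
    SectionVariationLE (f ∘ quadrantPoint p ε) (Icc 0 π) V where
  fst t _ := by
    have hsection : Function.Periodic (fun y x => f (x, y)) (2 * π) :=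
      fun y => funext fun x => hper.2 x y
    obtain ⟨y, hy, hty⟩ := hsection.exists_mem_Ico₀ Real.two_pi_pos (p.2 + ε.2 • t)
    calc eVariationOn (fun s => f (p.1 + ε.1 • s, p.2 + ε.2 • t)) (Icc 0 π)
        = eVariationOn (fun s => f (p.1 + ε.1 • s, y)) (Icc 0 π) := by
          simp only [fun x => congrFun hty x]
      _ ≤ eVariationOn (fun x => f (x, y)) (Icc 0 (2 * π)) :=
          eVariationOn_comp_add_units_smul_le (φ := fun x => f (x, y)) (fun x => hper.1 x y)
            Real.pi_pos p.1 ε.1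
      _ ≤ V := hf.fst y (Ico_subset_Icc_self hy)
  snd s _ := by
    have hsection : Function.Periodic (fun x y => f (x, y)) (2 * π) :=
      fun x => funext fun y => hper.1 x y
    obtain ⟨x, hx, hsx⟩ := hsection.exists_mem_Ico₀ Real.two_pi_pos (p.1 + ε.1 • s)
    calc eVariationOn (fun t => f (p.1 + ε.1 • s, p.2 + ε.2 • t)) (Icc 0 π)
        = eVariationOn (fun t => f (x, p.2 + ε.2 • t)) (Icc 0 π) := by
          simp only [fun y => congrFun hsx y]
      _ ≤ eVariationOn (fun y => f (x, y)) (Icc 0 (2 * π)) :=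
          eVariationOn_comp_add_units_smul_le (φ := fun y => f (x, y)) (fun y => hper.2 x y)
            Real.pi_pos p.2 ε.2
      _ ≤ V := hf.snd x (Ico_subset_Icc_self hx)

end SectionVariationLE

/-! ### Convergence of the Cesàro means -/

section Quadrants

variable {f : ℝ × ℝ → ℝ}

theorem cesaroKernel_sub_add_units_smul (a : ℝ) (n : ℕ) (x s : ℝ) (ε : ℤˣ) :
    cesaroKernel a n (x - (x + ε • s)) = cesaroKernel a n s := by
  rcases Int.units_eq_one_or ε with rfl | rfl <;> simp [cesaroKernel_neg]

theorem IsBiperiodic.mul_cesaroKernel (hper : IsBiperiodic f) (a b : ℝ) (n m : ℕ) (p : ℝ × ℝ) :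
    IsBiperiodic fun u => f u * (cesaroKernel a n (p.1 - u.1) * cesaroKernel b m (p.2 - u.2)) := by
  constructor <;> intro x y
  · simp only [hper.1 x y, ← sub_sub, (cesaroKernel_periodic a n).sub_eq]
  · simp only [hper.2 x y, ← sub_sub, (cesaroKernel_periodic b m).sub_eq]

theorem IsL1.mul_cesaroKernel (hf : IsL1 f) (a b : ℝ) (n m : ℕ) (p : ℝ × ℝ) :
    IsL1 fun u => f u * (cesaroKernel a n (p.1 - u.1) * cesaroKernel b m (p.2 - u.2)) :=
  IntegrableOn.mul_continuousOn hf (((continuous_cesaroKernel a n).comp (by fun_prop)).mul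
    ((continuous_cesaroKernel b m).comp (by fun_prop))).continuousOn isCompact_square

theorem cesaroMean_eq_sum_quadrants (hper : IsBiperiodic f) (hf : IsL1 f) {a b : ℝ} {n m : ℕ}
    (hn : cesaroNumber a n ≠ 0) (hm : cesaroNumber b m ≠ 0) (p : ℝ × ℝ) :
    cesaroMean a b f n m p = ((1 / (4 * π ^ 2) * ∑ ε : ℤˣ × ℤˣ, ∫ u in Ioc 0 π ×ˢ Ioc 0 π,
      f (quadrantPoint p ε u) * (cesaroKernel a n u.1 * cesaroKernel b m u.2) : ℝ) : ℂ) := by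
  rw [← Prod.mk.eta (p := p), cesaroMean_eq_integral hf hn hm,
    (hper.mul_cesaroKernel a b n m p).setIntegral_square_eq_sum (hf.mul_cesaroKernel a b n m p) p]
  simp only [quadrantPoint, cesaroKernel_sub_add_units_smul]

theorem setIntegral_cesaroKernel_mul_cesaroKernel (a b : ℝ) (n m : ℕ) :
    ∫ p in Ioc 0 π ×ˢ Ioc 0 π, cesaroKernel a n p.1 * cesaroKernel b m p.2 = π ^ 2 := by
  rw [Measure.volume_eq_prod, setIntegral_prod_mul (cesaroKernel a n) (cesaroKernel b m),
    ← intervalIntegral.integral_of_le Real.pi_pos.le,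
    ← intervalIntegral.integral_of_le Real.pi_pos.le, integral_cesaroKernel_zero_pi,
    integral_cesaroKernel_zero_pi, sq]

theorem integrableOn_const_Ioc_prod_Ioc (a b c d q : ℝ) :
    IntegrableOn (fun _ : ℝ × ℝ => q) (Ioc a b ×ˢ Ioc c d) :=
  (integrableOn_const (isCompact_Icc.prod isCompact_Icc).measure_ne_top).mono_set
    (prod_mono Ioc_subset_Icc_self Ioc_subset_Icc_self)

theorem setIntegral_sub_mul_cesaroKernel {g : ℝ × ℝ → ℝ}
    (hg : IntegrableOn g (Ioc 0 π ×ˢ Ioc 0 π)) (a b q : ℝ) (n m : ℕ) :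
    ∫ u in Ioc 0 π ×ˢ Ioc 0 π, (g u - q) * (cesaroKernel a n u.1 * cesaroKernel b m u.2) =
      (∫ u in Ioc 0 π ×ˢ Ioc 0 π, g u * (cesaroKernel a n u.1 * cesaroKernel b m u.2)) -
        π ^ 2 * q := by
  simp only [sub_mul]
  have hmul : ∀ h : ℝ × ℝ → ℝ, IntegrableOn h (Ioc 0 π ×ˢ Ioc 0 π) →
      IntegrableOn (fun u => h u * (cesaroKernel a n u.1 * cesaroKernel b m u.2))
        (Ioc 0 π ×ˢ Ioc 0 π) := fun _ hh =>
    integrableOn_Ioc_prod_mul_of_continuous hh (continuous_cesaroKernel a n)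
      (continuous_cesaroKernel b m)
  rw [integral_sub (hmul g hg) (hmul (fun _ => q) (integrableOn_const_Ioc_prod_Ioc 0 π 0 π q)),
    integral_const_mul, setIntegral_cesaroKernel_mul_cesaroKernel, mul_comm q]

theorem cesaroMean_sub_eq_sum_quadrants (hper : IsBiperiodic f) (hf : IsL1 f) {a b : ℝ} {n m : ℕ}
    (hn : cesaroNumber a n ≠ 0) (hm : cesaroNumber b m ≠ 0) (p : ℝ × ℝ) (q : ℤˣ × ℤˣ → ℝ) :
    cesaroMean a b f n m p - ((1 / 4 * ∑ ε, q ε : ℝ) : ℂ) =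
      ((1 / (4 * π ^ 2) * ∑ ε, ∫ u in Ioc 0 π ×ˢ Ioc 0 π, (f (quadrantPoint p ε u) - q ε) *
        (cesaroKernel a n u.1 * cesaroKernel b m u.2) : ℝ) : ℂ) := by
  have hsub := fun ε => setIntegral_sub_mul_cesaroKernel
    (hper.integrableOn_comp_quadrantPoint hf p ε) a b (q ε) n m
  simp only [Function.comp_apply] at hsub
  rw [cesaroMean_eq_sum_quadrants hper hf hn hm, ← Complex.ofReal_sub]
  simp only [hsub, Finset.sum_sub_distrib, ← Finset.mul_sum]
  congr 1
  field_simp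

theorem norm_cesaroMean_sub_le_of_quadrants (hper : IsBiperiodic f) (hf : IsL1 f) {a b e : ℝ}
    {n m : ℕ} (hn : cesaroNumber a n ≠ 0) (hm : cesaroNumber b m ≠ 0) {p : ℝ × ℝ}
    {q : ℤˣ × ℤˣ → ℝ} (hq : ∀ ε, |∫ u in Ioc 0 π ×ˢ Ioc 0 π, (f (quadrantPoint p ε u) - q ε) *
      (cesaroKernel a n u.1 * cesaroKernel b m u.2)| ≤ π ^ 2 * e) :
    ‖cesaroMean a b f n m p - ((1 / 4 * ∑ ε, q ε : ℝ) : ℂ)‖ ≤ e := by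
  rw [cesaroMean_sub_eq_sum_quadrants hper hf hn hm, Complex.norm_real, Real.norm_eq_abs, abs_mul,
    abs_of_pos (by positivity), div_mul_eq_mul_div, one_mul, div_le_iff₀' (by positivity)]
  calc _ ≤ ∑ _ε : ℤˣ × ℤˣ, π ^ 2 * e :=
        (Finset.abs_sum_le_sum_abs _ _).trans (Finset.sum_le_sum fun ε _ => hq ε)
    _ = 4 * π ^ 2 * e := by
        simp [mul_assoc]

end Quadrants

theorem exists_quadrant_bound_le {α β : ℝ} (hαβ : α + β < 1) (c V : ℝ) {e : ℝ} (he : 0 < e) :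
    ∃ R ≥ (1 : ℝ), ∃ η > 0, c * (R ^ α / α * (R ^ β / β)) * η +
      c * (η + 3 * V) * ((1 / α + 1 / β + 2 / (1 - α - β)) * R ^ (α + β - 1)) ≤ e := by
  set κ := 1 / α + 1 / β + 2 / (1 - α - β)
  have htail : Tendsto (fun R : ℝ => c * (3 * V) * (κ * R ^ (α + β - 1))) atTop (𝓝 0) := by
    have h := ((tendsto_rpow_neg_atTop (show 0 < 1 - (α + β) by linarith)).const_mul κ).const_mul
      (c * (3 * V))
    simpa only [neg_sub, mul_zero] using h
  obtain ⟨R, hR, hRe⟩ := ((eventually_ge_atTop 1).and (htail.eventually_lt_const he)).exists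
  have hcont : ContinuousAt (fun η => c * (R ^ α / α * (R ^ β / β)) * η +
      c * (η + 3 * V) * (κ * R ^ (α + β - 1))) 0 := by fun_prop
  obtain ⟨η, hη, hηe⟩ := ((eventually_mem_nhdsWithin (a := (0 : ℝ)) (s := Ioi 0)).and
    ((hcont.eventually_lt_const (by simpa using hRe)).filter_mono nhdsWithin_le_nhds)).exists
  exact ⟨R, hR, η, hη, hηe.le⟩

theorem eventually_le_and_div_lt (R : ℝ) {δ : ℝ} (hδ : 0 < δ) :
    ∀ᶠ n : ℕ in atTop, R ≤ n + 1 ∧ R / (n + 1) < δ := by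
  have hsucc : Tendsto (fun n : ℕ => (n : ℝ) + 1) atTop atTop :=
    tendsto_atTop_add_const_right _ _ tendsto_natCast_atTop_atTop
  exact (hsucc.eventually_ge_atTop R).and
    ((hsucc.const_div_atTop R).eventually_lt_const hδ)

theorem exists_eventually_norm_cesaroMean_sub_le {α β : ℝ} (hα : α ∈ Ioo (0 : ℝ) 1)
    (hβ : β ∈ Ioo (0 : ℝ) 1) (hαβ : α + β < 1) {f : ℝ × ℝ → ℝ} (hper : IsBiperiodic f)
    (hL1 : IsL1 f) (hf : IsPBV f) {e : ℝ} (he : 0 < e) :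
    ∃ η > 0, ∀ δ > 0, ∀ᶠ nm : ℕ × ℕ in atTop ×ˢ atTop, ∀ (p : ℝ × ℝ) (q : ℤˣ × ℤˣ → ℝ),
      (∀ ε, ∀ u ∈ Ioo 0 δ ×ˢ Ioo 0 δ, |f (quadrantPoint p ε u) - q ε| ≤ η) →
      ‖cesaroMean (-α) (-β) f nm.1 nm.2 p - ((1 / 4 * ∑ ε, q ε : ℝ) : ℂ)‖ ≤ e := by
  obtain ⟨V, hV⟩ := hf.exists_sectionVariationLE
  obtain ⟨C, hC⟩ := exists_isKernelBound_cesaroKernel hα.1 hα.2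
  obtain ⟨D, hD⟩ := exists_isKernelBound_cesaroKernel hβ.1 hβ.2
  obtain ⟨R, hR, η, hη, hRη⟩ :=
    exists_quadrant_bound_le hαβ (C * D) V (show 0 < π ^ 2 * e by positivity)
  refine ⟨η, hη, fun δ hδ => ?_⟩
  filter_upwards [(eventually_le_and_div_lt R hδ).prod_mk (eventually_le_and_div_lt R hδ)]
    with ⟨n, m⟩ ⟨⟨hn, hnδ⟩, hm, hmδ⟩ p q hq
  refine norm_cesaroMean_sub_le_of_quadrants hper hL1 (cesaroNumber_neg_pos hα.2 n).ne'
    (cesaroNumber_neg_pos hβ.2 m).ne' fun ε => le_trans ?_ hRη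
  refine (hC n).abs_setIntegral_mul_mul_le (hD m) hα.1 hβ.1 hαβ hR hn hm
    ((hper.integrableOn_comp_quadrantPoint hL1 p ε).sub (integrableOn_const_Ioc_prod_Ioc 0 π 0 π _))
    ((hV.comp_quadrantPoint hper p ε).sub_const (q ε)) fun u hu => hq ε u ?_
  exact ⟨⟨hu.1.1, hu.1.2.trans_lt hnδ⟩, hu.2.1, hu.2.2.trans_lt hmδ⟩

theorem tendsto_add_units_smul_nhdsGT (x : ℝ) (ε : ℤˣ) :
    Tendsto (fun s => x + ε • s) (𝓝[>] 0) (if ε = 1 then 𝓝[>] x else 𝓝[<] x) := by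
  have hcont : Continuous fun s : ℝ => x + ε • s := by fun_prop
  have hlim : Tendsto (fun s => x + ε • s) (𝓝[>] 0) (𝓝 x) := by
    simpa using (hcont.tendsto 0).mono_left nhdsWithin_le_nhds
  rcases Int.units_eq_one_or ε with rfl | rfl <;>
  · refine tendsto_nhdsWithin_iff.2 ⟨hlim, ?_⟩
    filter_upwards [self_mem_nhdsWithin] with s (hs : 0 < s)
    simpa using hs

theorem HasQuadrantLimits.exists_tendsto_quadrantPoint {f : ℝ × ℝ → ℝ} {x y q₁ q₂ q₃ q₄ : ℝ}
    (h : HasQuadrantLimits f x y q₁ q₂ q₃ q₄) :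
    ∃ q : ℤˣ × ℤˣ → ℝ, ∑ ε, q ε = q₁ + q₂ + q₃ + q₄ ∧
      ∀ ε, Tendsto (f ∘ quadrantPoint (x, y) ε) (𝓝[>] 0 ×ˢ 𝓝[>] 0) (𝓝 (q ε)) := by
  have hne : (-1 : ℤˣ) ≠ 1 := by decide
  obtain ⟨h₁, h₂, h₃, h₄⟩ := h
  refine ⟨fun ε => if ε.1 = 1 then (if ε.2 = 1 then q₁ else q₂) else if ε.2 = 1 then q₃ else q₄,
    by simp [Fintype.sum_prod_type, hne, add_assoc], fun ⟨ε₁, ε₂⟩ => ?_⟩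
  have hquad := (tendsto_add_units_smul_nhdsGT x ε₁).prodMap (tendsto_add_units_smul_nhdsGT y ε₂)
  rcases Int.units_eq_one_or ε₁ with rfl | rfl <;> rcases Int.units_eq_one_or ε₂ with rfl | rfl
  · exact h₁.comp hquad
  · exact h₂.comp hquad
  · exact h₃.comp hquad
  · exact h₄.comp hquad

theorem exists_forall_abs_sub_le_of_tendsto {f : ℝ × ℝ → ℝ} {p : ℝ × ℝ} {q : ℤˣ × ℤˣ → ℝ}
    (h : ∀ ε, Tendsto (f ∘ quadrantPoint p ε) (𝓝[>] 0 ×ˢ 𝓝[>] 0) (𝓝 (q ε))) {η : ℝ}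
    (hη : 0 < η) :
    ∃ δ > 0, ∀ ε, ∀ u ∈ Ioo 0 δ ×ˢ Ioo 0 δ, |f (quadrantPoint p ε u) - q ε| ≤ η := by
  have hev : ∀ᶠ u in 𝓝[>] (0 : ℝ) ×ˢ 𝓝[>] (0 : ℝ), ∀ ε, |f (quadrantPoint p ε u) - q ε| ≤ η :=
    eventually_all.2 fun ε => (h ε).eventually (Metric.closedBall_mem_nhds (q ε) hη)
  obtain ⟨δ, hδ, H⟩ := (nhdsGT_basis (0 : ℝ)).prod_self.eventually_iff.1 hev
  exact ⟨δ, hδ, fun ε u hu => H hu ε⟩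

theorem cesaroSummableAt_of_hasQuadrantLimits {α β : ℝ} (hα : α ∈ Ioo (0 : ℝ) 1)
    (hβ : β ∈ Ioo (0 : ℝ) 1) (hαβ : α + β < 1) {f : ℝ × ℝ → ℝ} (hper : IsBiperiodic f)
    (hL1 : IsL1 f) (hf : IsPBV f) {x y q₁ q₂ q₃ q₄ : ℝ} (h : HasQuadrantLimits f x y q₁ q₂ q₃ q₄) :
    CesaroSummableAt (-α) (-β) f (x, y) ((1 / 4) * (q₁ + q₂ + q₃ + q₄)) := by
  obtain ⟨q, hsum, hq⟩ := h.exists_tendsto_quadrantPoint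
  rw [← hsum]
  refine Metric.tendsto_nhds.2 fun e he => ?_
  obtain ⟨η, hη, H⟩ :=
    exists_eventually_norm_cesaroMean_sub_le hα hβ hαβ hper hL1 hf (half_pos he)
  obtain ⟨δ, hδ, hδη⟩ := exists_forall_abs_sub_le_of_tendsto hq hη
  filter_upwards [H δ hδ] with nm hnm
  rw [dist_eq_norm]
  exact (hnm (x, y) q hδη).trans_lt (half_lt_self he)

theorem dist_quadrantPoint_lt {p u : ℝ × ℝ} {δ : ℝ} (hu : u ∈ Ioo 0 δ ×ˢ Ioo 0 δ)
    (ε : ℤˣ × ℤˣ) : dist p (quadrantPoint p ε u) < δ := by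
  have hnorm : ∀ (ε : ℤˣ) {s : ℝ}, s ∈ Ioo 0 δ → ‖ε • s‖ < δ := by
    intro ε s hs
    rcases Int.units_eq_one_or ε with rfl | rfl <;> simpa [abs_of_pos hs.1] using hs.2
  rw [quadrantPoint, Prod.dist_eq, dist_self_add_right, dist_self_add_right, max_lt_iff]
  exact ⟨hnorm ε.1 hu.1, hnorm ε.2 hu.2⟩

theorem cesaroSummableUniformlyOn_of_continuousAt {α β : ℝ} (hα : α ∈ Ioo (0 : ℝ) 1)
    (hβ : β ∈ Ioo (0 : ℝ) 1) (hαβ : α + β < 1) {f : ℝ × ℝ → ℝ} (hper : IsBiperiodic f)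
    (hL1 : IsL1 f) (hf : IsPBV f) {K : Set (ℝ × ℝ)} (hK : IsCompact K)
    (hc : ∀ p ∈ K, ContinuousAt f p) : CesaroSummableUniformlyOn (-α) (-β) f K := by
  refine Metric.tendstoUniformlyOn_iff.2 fun e he => ?_
  obtain ⟨η, hη, H⟩ :=
    exists_eventually_norm_cesaroMean_sub_le hα hβ hαβ hper hL1 hf (half_pos he)
  obtain ⟨δ, hδ, hδη⟩ := Metric.mem_uniformity_dist.1
    (hK.uniformContinuousAt_of_continuousAt f hc (Metric.dist_mem_uniformity hη))
  filter_upwards [H δ hδ] with nm hnm p hp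
  have hquad : ∀ ε, ∀ u ∈ Ioo 0 δ ×ˢ Ioo 0 δ, |f (quadrantPoint p ε u) - f p| ≤ η := by
    intro ε u hu
    rw [← Real.dist_eq, dist_comm]
    exact (hδη (dist_quadrantPoint_lt hu ε) hp).le
  have hmean := hnm p (fun _ => f p) hquad
  rw [show 1 / 4 * ∑ _ε : ℤˣ × ℤˣ, f p = f p by simp] at hmean
  rw [dist_comm, dist_eq_norm]
  exact hmean.trans_lt (half_lt_self he)

end DoubleFourier

theorem corollary2 (α β : ℝ) (hα : α ∈ Ioo (0 : ℝ) 1) (hβ : β ∈ Ioo (0 : ℝ) 1)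
    (hαβ : α + β < 1) (f : ℝ × ℝ → ℝ) (hper : DoubleFourier.IsBiperiodic f)
    (hL1 : DoubleFourier.IsL1 f) (hf : DoubleFourier.IsPBV f) :
    (∀ x y q₁ q₂ q₃ q₄ : ℝ, DoubleFourier.HasQuadrantLimits f x y q₁ q₂ q₃ q₄ →
      DoubleFourier.CesaroSummableAt (-α) (-β) f (x, y) ((1 / 4) * (q₁ + q₂ + q₃ + q₄))) ∧
    (∀ K : Set (ℝ × ℝ), IsCompact K → (∀ p ∈ K, ContinuousAt f p) →
      DoubleFourier.CesaroSummableUniformlyOn (-α) (-β) f K) :=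
  ⟨fun _ _ _ _ _ _ h =>
      DoubleFourier.cesaroSummableAt_of_hasQuadrantLimits hα hβ hαβ hper hL1 hf h,
    fun _ hK hc =>
      DoubleFourier.cesaroSummableUniformlyOn_of_continuousAt hα hβ hαβ hper hL1 hf hK hc⟩
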